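/- **Setting.** Let $r\ge 0$ be an integer and let $\kappa$ be a real-valued continuous function on $[0,1]\times[0,1]$ of Green's function type: there are $\kappa_1\in C^{2r+2}(\{0\le t\le s\le 1\})$ and $\kappa_2\in C^{2r+2}(\{0\le s\le t\le 1\})$ with $\kappa(s,t)=\kappa_1(s,t)$ for $t\le s$ and $\kappa(s,t)=\kappa_2(s,t)$ for $s\le t$. Let $(\mathcal K x)(s)=\int_0^1\kappa(s,t)x(t)\,dt$, regarded as an operator on the complex space $L^\infty[0,1]$ with norm $\|\cdot\|_\infty$; it maps into $C[0,1]$. For $n\ge1$ let $h=1/n$ and $t_j=j/n$. In each subinterval $[t_{j-1},t_j]$, $1\le j\le n$, take the $2r+1$ equidistant points $\tau_j^i=t_{j-1}+\frac{ih}{2r}$, $0\le i\le 2r$ (for $r=0$ the single point $\tau_j=\frac{t_{j-1}+t_j}{2}$). For $x\in C[0,1]$ let $Q_nx\in L^\infty[0,1]$ be the piecewise polynomial whose restriction to the $j$-th subinterval is the polynomial of degree at most $2r$ that agrees with $x$ at these $2r+1$ points. For a bounded operator $T$ on $L^\infty[0,1]$ and a positively oriented circle $\Gamma$ in its resolvent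 set, the spectral projection of $T$ is $-\frac1{2\pi i}\int_\Gamma (T-zI)^{-1}dz$. A number $\mu$ is called a simple eigenvalue of $T$ isolated by $\Gamma$ if $\Gamma$ lies in the resolvent set of $T$, $\mu$ is the only point of the spectrum of $T$ inside $\Gamma$, $\mu$ is an eigenvalue of $T$, and the spectral projection has rank one. **Theorem.** Let $\lambda\ne0$ be a simple eigenvalue of $\mathcal K$, isolated by a circle $\Gamma$, with spectral projection $E$. Then there are constants $C$ and $N$, which do not depend on $n$, such that for all $n\ge N$ the operator $Q_n\mathcal K$ has inside $\Gamma$ exactly one spectral value $\lambda_n^C$; it is nonzero and a simple eigenvalue of $Q_n\mathcal K$ isolated by $\Gamma$; and $$|\lambda-\lambda_n^C|\le C\,h^{2r+2}.$$ Moreover, let $E_n$ be the spectral projection of $Q_n\mathcal K$ for $\Gamma$. Every $\varphi_n\in\mathcal R(E_n)$ with $\|\varphi_n\|_\infty=1$ satisfies $Q_n\mathcal K\varphi_n=\lambda_n^C\varphi_n$ (a collocation eigenvector), and with the iterated collocation eigenvector $\varphi_n^S=\frac1{\lambda_n^C}\mathcal K\varphi_n$ one has $$\|\varphi_n-E\varphi_n\|_\infty\le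 C\,h^{2r+1},\qquad \|\varphi_n^S-E\varphi_n^S\|_\infty\le C\,h^{2r+2}.$$ -/

import Mathlib

open MeasureTheory Set
open scoped ENNReal unitInterval

noncomputable section

namespace Collocation

/-- The complex Banach space `L^∞[0,1]`, with the (essential) supremum norm. -/
abbrev Linf : Type := Lp ℂ ∞ (volume : Measure I)

/-- The closed triangle `0 ≤ t ≤ s ≤ 1`, as a set of points `(s, t)`. -/
def lowerTriangle : Set (ℝ × ℝ) := {p | 0 ≤ p.2 ∧ p.2 ≤ p.1 ∧ p.1 ≤ 1}

/-- The closed triangle `0 ≤ s ≤ t ≤ 1`, as a set of points `(s, t)`. -/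
def upperTriangle : Set (ℝ × ℝ) := {p | 0 ≤ p.1 ∧ p.1 ≤ p.2 ∧ p.2 ≤ 1}

/-- A continuous kernel on the unit square is of Green's function type (of class `C^m`) if it is
given by a `C^m` function on each of the two closed triangles. (The two functions agree on the
diagonal, since both equal `κ` there.) -/
def IsGreenKernel (m : ℕ) (κ : C(I × I, ℝ)) : Prop :=
  ∃ κ₁ κ₂ : ℝ × ℝ → ℝ,
    ContDiffOn ℝ m κ₁ lowerTriangle ∧ ContDiffOn ℝ m κ₂ upperTriangle ∧
    (∀ s t : I, t ≤ s → κ (s, t) = κ₁ (s, t)) ∧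
    (∀ s t : I, s ≤ t → κ (s, t) = κ₂ (s, t))

/-! ### The integral operator -/

lemma integrable_coe (x : Linf) : Integrable (fun t : I => x t) volume :=
  (Lp.memLp x).integrable le_top

lemma aestronglyMeasurable_kernel (κ : C(I × I, ℝ)) (x : Linf) (s : I) :
    AEStronglyMeasurable (fun t : I => (κ (s, t) : ℂ) * x t) volume := by
  refine AEStronglyMeasurable.mul (Continuous.aestronglyMeasurable ?_)
    (Lp.aestronglyMeasurable x)
  fun_prop

lemma norm_kernel_le (κ : C(I × I, ℝ)) (x : Linf) (s t : I) :
    ‖(κ (s, t) : ℂ) * x t‖ ≤ ‖κ‖ * ‖x t‖ := by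
  rw [norm_mul, Complex.norm_real]
  exact mul_le_mul_of_nonneg_right (κ.norm_coe_le_norm _) (norm_nonneg _)

lemma integrable_kernel (κ : C(I × I, ℝ)) (x : Linf) (s : I) :
    Integrable (fun t : I => (κ (s, t) : ℂ) * x t) volume :=
  ((integrable_coe x).norm.const_mul ‖κ‖).mono' (aestronglyMeasurable_kernel κ x s)
    (Filter.Eventually.of_forall (norm_kernel_le κ x s))

lemma continuous_integral_kernel (κ : C(I × I, ℝ)) (x : Linf) :
    Continuous fun s : I => ∫ t : I, (κ (s, t) : ℂ) * x t := by
  refine continuous_of_dominated (bound := fun t => ‖κ‖ * ‖x t‖)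
    (aestronglyMeasurable_kernel κ x)
    (fun s => Filter.Eventually.of_forall (norm_kernel_le κ x s))
    ((integrable_coe x).norm.const_mul ‖κ‖) (Filter.Eventually.of_forall fun t => ?_)
  fun_prop

lemma norm_integral_kernel_le (κ : C(I × I, ℝ)) (x : Linf) (s : I) :
    ‖∫ t : I, (κ (s, t) : ℂ) * x t‖ ≤ ‖κ‖ * ‖x‖ := by
  have hx : ∀ᵐ t : I, ‖x t‖ ≤ ‖x‖ := by
    have h := ae_le_eLpNormEssSup (f := fun t : I => x t) (μ := (volume : Measure I))
    filter_upwards [h] with t ht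
    rw [Lp.norm_def, eLpNorm_exponent_top]
    have hfin : eLpNormEssSup (fun t : I => x t) volume ≠ ∞ := by
      simpa [eLpNorm_exponent_top] using (Lp.memLp x).eLpNorm_ne_top
    simpa using ENNReal.toReal_mono hfin ht
  have h := norm_integral_le_of_norm_le_const (μ := (volume : Measure I))
    (f := fun t : I => (κ (s, t) : ℂ) * x t) (C := ‖κ‖ * ‖x‖) (by
      filter_upwards [hx] with t ht
      exact (norm_kernel_le κ x s t).trans (mul_le_mul_of_nonneg_left ht (norm_nonneg _)))
  simpa using h

/-- The integral operator `(𝒦 x)(s) = ∫₀¹ κ(s, t) x(t) dt`, as a bounded operator from `L^∞[0,1]`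
to `C[0,1]`. -/
def integralOpC (κ : C(I × I, ℝ)) : Linf →L[ℂ] C(I, ℂ) :=
  LinearMap.mkContinuous
    { toFun := fun x => ⟨fun s => ∫ t : I, (κ (s, t) : ℂ) * x t, continuous_integral_kernel κ x⟩
      map_add' := fun x y => by
        ext s
        simp only [ContinuousMap.coe_mk, ContinuousMap.add_apply]
        rw [← integral_add (integrable_kernel κ x s) (integrable_kernel κ y s)]
        refine integral_congr_ae ?_
        filter_upwards [Lp.coeFn_add x y] with t ht
        rw [ht, Pi.add_apply, mul_add]
      map_smul' := fun a x => by
        ext s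
        simp only [ContinuousMap.coe_mk, ContinuousMap.smul_apply, RingHom.id_apply, smul_eq_mul]
        rw [← integral_const_mul]
        refine integral_congr_ae ?_
        filter_upwards [Lp.coeFn_smul a x] with t ht
        rw [ht, Pi.smul_apply, smul_eq_mul]
        ring }
    ‖κ‖
    (fun x => (ContinuousMap.norm_le _ (by positivity)).2 (norm_integral_kernel_le κ x))

/-- The integral operator `𝒦` as a bounded operator on `L^∞[0,1]`. -/
def integralOp (κ : C(I × I, ℝ)) : Linf →L[ℂ] Linf :=
  (ContinuousMap.toLp (E := ℂ) ∞ (volume : Measure I) ℂ) ∘L integralOpC κ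

/-! ### The interpolatory projection -/

/-- The relative position in a subinterval of the `i`-th of `2r+1` equidistant nodes: `i / (2r)`,
and the midpoint if `r = 0`. -/
def relNode (r : ℕ) (i : Fin (2 * r + 1)) : ℝ :=
  if r = 0 then 1 / 2 else (i : ℝ) / (2 * r)

lemma relNode_mem (r : ℕ) (i : Fin (2 * r + 1)) : relNode r i ∈ Icc (0 : ℝ) 1 := by
  unfold relNode
  split_ifs with h
  · norm_num
  · have hr : (0 : ℝ) < 2 * r := by positivity
    have hi : (i : ℝ) ≤ 2 * r := by exact_mod_cast Nat.lt_succ_iff.1 i.2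
    exact ⟨by positivity, (div_le_one hr).2 hi⟩

/-- The `i`-th interpolation node in the subinterval `[j/n, (j+1)/n]`, for `j = 0, …, n-1`. -/
def node (r n : ℕ) (j : Fin n) (i : Fin (2 * r + 1)) : ℝ := (j + relNode r i) / n

lemma node_mem (r n : ℕ) (j : Fin n) (i : Fin (2 * r + 1)) : node r n j i ∈ Icc (0 : ℝ) 1 := by
  obtain ⟨h0, h1⟩ := relNode_mem r i
  have hj : (j : ℝ) + 1 ≤ n := by exact_mod_cast j.2
  have hn : (0 : ℝ) < n := by exact_mod_cast j.pos
  exact ⟨by unfold node; positivity, by unfold node; rw [div_le_one hn]; linarith⟩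

/-- The piecewise polynomial that is on `(j/n, (j+1)/n]` the `i`-th Lagrange basis polynomial (of
degree `2r`) for the nodes in this subinterval, and zero on the other subintervals. -/
def basisFun (r n : ℕ) (j : Fin n) (i : Fin (2 * r + 1)) : I → ℂ :=
  indicator {t : I | (t : ℝ) ∈ Ioc ((j : ℝ) / n) ((j + 1 : ℝ) / n)}
    fun t => (((Lagrange.basis Finset.univ (node r n j) i).eval (t : ℝ) : ℝ) : ℂ)

lemma basisFun_memLp (r n : ℕ) (j : Fin n) (i : Fin (2 * r + 1)) :
    MemLp (basisFun r n j i) ∞ (volume : Measure I) := by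
  refine MemLp.indicator (measurableSet_Ioc.preimage measurable_subtype_coe) ?_
  have hc : Continuous fun t : I =>
      (((Lagrange.basis Finset.univ (node r n j) i).eval (t : ℝ) : ℝ) : ℂ) := by fun_prop
  exact (Lp.memLp (ContinuousMap.toLp (E := ℂ) ∞ (volume : Measure I) ℂ ⟨_, hc⟩)).ae_eq
    (ContinuousMap.coeFn_toLp _ _)

/-- The interpolatory projection `Q_n : C[0,1] → X_n ⊆ L^∞[0,1]`: on each subinterval
`[j/n, (j+1)/n]`, `Q_n x` is the polynomial of degree at most `2r` that agrees with `x` at the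
`2r+1` nodes of the subinterval, in Lagrange form. -/
def interpOp (r n : ℕ) : C(I, ℂ) →L[ℂ] Linf :=
  ∑ j : Fin n, ∑ i : Fin (2 * r + 1),
    (ContinuousMap.evalCLM ℂ (⟨node r n j i, node_mem r n j i⟩ : I)).smulRight
      ((basisFun_memLp r n j i).toLp (basisFun r n j i))

/-- The collocation operator `Q_n 𝒦` on `L^∞[0,1]`. -/
def collocationOp (r n : ℕ) (κ : C(I × I, ℝ)) : Linf →L[ℂ] Linf :=
  interpOp r n ∘L integralOpC κ

/-! ### Spectral projections and simple eigenvalues -/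

/-- The spectral projection `-(2πi)⁻¹ ∮ (T - z)⁻¹ dz = (2πi)⁻¹ ∮ (z - T)⁻¹ dz`, over the
positively oriented circle with centre `c` and radius `R`. -/
def spectralProj (T : Linf →L[ℂ] Linf) (c : ℂ) (R : ℝ) : Linf →L[ℂ] Linf :=
  (2 * Real.pi * Complex.I : ℂ)⁻¹ • ∮ z in C(c, R), resolvent T z

/-- The circle with centre `c` and radius `R` lies in the resolvent set of `T`, the only point of
the spectrum inside the circle is `μ`, and `μ` is a simple eigenvalue of `T`: its algebraic
multiplicity, which is the rank of the spectral projection, is one. -/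
structure IsSimpleEigenvalueIn (T : Linf →L[ℂ] Linf) (c : ℂ) (R : ℝ) (μ : ℂ) : Prop where
  circle_subset : Metric.sphere c R ⊆ resolventSet ℂ T
  spectrum_inside : spectrum ℂ T ∩ Metric.ball c R = {μ}
  hasEigenvalue : Module.End.HasEigenvalue (T : Linf →ₗ[ℂ] Linf) μ
  rank_eq_one : Module.finrank ℂ (LinearMap.range (spectralProj T c R : Linf →ₗ[ℂ] Linf)) = 1

end Collocation

end

noncomputable section

namespace Collocation

open Metric

/-! ### Contour integrals of the resolvent in a Banach algebra -/

lemma _root_.ContinuousLinearMap.circleIntegral_comp_comm {E F : Type*} [NormedAddCommGroup E]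
    [NormedSpace ℂ E] [CompleteSpace E] [NormedAddCommGroup F] [NormedSpace ℂ F] [CompleteSpace F]
    (L : E →L[ℂ] F) {f : ℂ → E} {c : ℂ} {R : ℝ} (hf : CircleIntegrable f c R) :
    L (∮ z in C(c, R), f z) = ∮ z in C(c, R), L (f z) := by
  unfold circleIntegral
  rw [← ContinuousLinearMap.intervalIntegral_comp_comm L hf.out]
  simp

section Algebra

variable {A : Type*} [NormedRing A] [NormedAlgebra ℂ A]

/-- The contour integral `(2πi)⁻¹ ∮ (z - a)⁻¹ dz`. -/
def rieszProj (a : A) (c : ℂ) (R : ℝ) : A :=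
  (2 * Real.pi * Complex.I : ℂ)⁻¹ • ∮ z in C(c, R), resolvent a z

/-- The contour integral `(2πi)⁻¹ ∮ (z - w)⁻¹ (z - a)⁻¹ dz`. -/
def reducedResolvent (a : A) (c : ℂ) (R : ℝ) (w : ℂ) : A :=
  (2 * Real.pi * Complex.I : ℂ)⁻¹ • ∮ z in C(c, R), (z - w)⁻¹ • resolvent a z

lemma sub_mul_resolvent {a : A} {z : ℂ} (hz : z ∈ resolventSet ℂ a) :
    (algebraMap ℂ A z - a) * resolvent a z = 1 :=
  Ring.mul_inverse_cancel _ hz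

lemma resolvent_mul_sub {a : A} {z : ℂ} (hz : z ∈ resolventSet ℂ a) :
    resolvent a z * (algebraMap ℂ A z - a) = 1 :=
  Ring.inverse_mul_cancel _ hz

variable [CompleteSpace A] {a : A} {c w : ℂ} {R : ℝ}

lemma continuousOn_resolvent (a : A) : ContinuousOn (resolvent a) (resolventSet ℂ a) :=
  fun _ hz => (spectrum.hasDerivAt_resolvent_const_left hz).continuousAt.continuousWithinAt

lemma circleIntegrable_resolvent (hR : 0 ≤ R) (hΓ : sphere c R ⊆ resolventSet ℂ a) :
    CircleIntegrable (resolvent a) c R :=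
  ((continuousOn_resolvent a).mono hΓ).circleIntegrable hR

lemma continuousOn_sub_inv (hw : w ∉ sphere c R) :
    ContinuousOn (fun z : ℂ => (z - w)⁻¹) (sphere c R) := by
  refine (continuousOn_id.sub continuousOn_const).inv₀ fun z hz h => hw ?_
  exact (sub_eq_zero.1 h : z = w) ▸ hz

lemma circleIntegrable_reduced (hR : 0 ≤ R) (hΓ : sphere c R ⊆ resolventSet ℂ a)
    (hw : w ∉ sphere c R) :
    CircleIntegrable (fun z => (z - w)⁻¹ • resolvent a z) c R :=
  ((continuousOn_sub_inv hw).smul ((continuousOn_resolvent a).mono hΓ)).circleIntegrable hR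

lemma circleIntegral_mul_left (b : A) {f : ℂ → A} (hf : CircleIntegrable f c R) :
    b * (∮ z in C(c, R), f z) = ∮ z in C(c, R), b * f z :=
  (ContinuousLinearMap.mul ℂ A b).circleIntegral_comp_comm hf

lemma circleIntegral_mul_right (b : A) {f : ℂ → A} (hf : CircleIntegrable f c R) :
    (∮ z in C(c, R), f z) * b = ∮ z in C(c, R), f z * b :=
  ((ContinuousLinearMap.mul ℂ A).flip b).circleIntegral_comp_comm hf

lemma circleIntegral_reduced_sub (hR : 0 ≤ R) (hΓ : sphere c R ⊆ resolventSet ℂ a)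
    (hw : w ∉ sphere c R) :
    (2 * Real.pi * Complex.I : ℂ)⁻¹ •
      (∮ z in C(c, R), ((z - w)⁻¹ • (1 : A) - resolvent a z)) =
    ((2 * Real.pi * Complex.I : ℂ)⁻¹ * ∮ z in C(c, R), (z - w)⁻¹) • (1 : A)
      - rieszProj a c R := by
  rw [circleIntegral.integral_sub, circleIntegral.integral_smul_const, smul_sub, smul_smul,
    rieszProj]
  · exact ((continuousOn_sub_inv hw).smul continuousOn_const).circleIntegrable hR
  · exact circleIntegrable_resolvent hR hΓ

lemma sub_mul_reducedResolvent (hR : 0 ≤ R) (hΓ : sphere c R ⊆ resolventSet ℂ a)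
    (hw : w ∉ sphere c R) :
    (algebraMap ℂ A w - a) * reducedResolvent a c R w =
    ((2 * Real.pi * Complex.I : ℂ)⁻¹ * ∮ z in C(c, R), (z - w)⁻¹) • (1 : A)
      - rieszProj a c R := by
  rw [← circleIntegral_reduced_sub hR hΓ hw, reducedResolvent, mul_smul_comm,
    circleIntegral_mul_left _ (circleIntegrable_reduced hR hΓ hw)]
  congr 1
  refine circleIntegral.integral_congr hR fun z hz => ?_
  have hzw : z - w ≠ 0 := fun h => hw (by rwa [← sub_eq_zero.1 h])
  have h : algebraMap ℂ A w - a = (algebraMap ℂ A z - a) - (z - w) • 1 := by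
    rw [← Algebra.algebraMap_eq_smul_one, map_sub]; abel
  simp only [mul_smul_comm]
  rw [h, sub_mul, sub_mul_resolvent (hΓ hz), smul_mul_assoc, one_mul, smul_sub, smul_smul,
    inv_mul_cancel₀ hzw, one_smul]

lemma reducedResolvent_mul_sub (hR : 0 ≤ R) (hΓ : sphere c R ⊆ resolventSet ℂ a)
    (hw : w ∉ sphere c R) :
    reducedResolvent a c R w * (algebraMap ℂ A w - a) =
    ((2 * Real.pi * Complex.I : ℂ)⁻¹ * ∮ z in C(c, R), (z - w)⁻¹) • (1 : A)
      - rieszProj a c R := by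
  rw [← circleIntegral_reduced_sub hR hΓ hw, reducedResolvent, smul_mul_assoc,
    circleIntegral_mul_right _ (circleIntegrable_reduced hR hΓ hw)]
  congr 1
  refine circleIntegral.integral_congr hR fun z hz => ?_
  have hzw : z - w ≠ 0 := fun h => hw (by rwa [← sub_eq_zero.1 h])
  have h : algebraMap ℂ A w - a = (algebraMap ℂ A z - a) - (z - w) • 1 := by
    rw [← Algebra.algebraMap_eq_smul_one, map_sub]; abel
  simp only [smul_mul_assoc]
  rw [h, mul_sub, resolvent_mul_sub (hΓ hz), mul_smul_comm, mul_one, smul_sub, smul_smul,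
    inv_mul_cancel₀ hzw, one_smul]

lemma cauchy_coeff_of_mem_ball (hw : w ∈ ball c R) :
    (2 * Real.pi * Complex.I : ℂ)⁻¹ * ∮ z in C(c, R), (z - w)⁻¹ = 1 := by
  rw [circleIntegral.integral_sub_inv_of_mem_ball hw]
  exact inv_mul_cancel₀ Complex.two_pi_I_ne_zero

lemma cauchy_coeff_of_notMem (hR : 0 ≤ R) (hw : w ∉ closedBall c R) :
    (2 * Real.pi * Complex.I : ℂ)⁻¹ * ∮ z in C(c, R), (z - w)⁻¹ = 0 := by
  have hd : DifferentiableOn ℂ (fun z : ℂ => (z - w)⁻¹) (closedBall c R) := by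
    intro z hz
    have : z - w ≠ 0 := fun h => hw (by rwa [← sub_eq_zero.1 h])
    fun_prop (disch := assumption)
  rw [DiffContOnCl.circleIntegral_eq_zero hR, mul_zero]
  exact DifferentiableOn.diffContOnCl (hd.mono closure_ball_subset_closedBall)

lemma rieszProj_commute (hR : 0 ≤ R) (hΓ : sphere c R ⊆ resolventSet ℂ a) :
    a * rieszProj a c R = rieszProj a c R * a := by
  have hi := circleIntegrable_resolvent hR hΓ
  rw [rieszProj, mul_smul_comm, smul_mul_assoc, circleIntegral_mul_left _ hi,
    circleIntegral_mul_right _ hi]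
  congr 1
  refine circleIntegral.integral_congr hR fun z hz => ?_
  have h1 := sub_mul_resolvent (hΓ hz)
  have h2 := resolvent_mul_sub (hΓ hz)
  rw [sub_mul, Algebra.algebraMap_eq_smul_one, smul_mul_assoc, one_mul] at h1
  rw [mul_sub, Algebra.algebraMap_eq_smul_one, mul_smul_comm, mul_one] at h2
  have := h1.trans h2.symm
  exact sub_right_injective this

lemma reducedResolvent_analytic (hR : 0 < R) (hΓ : sphere c R ⊆ resolventSet ℂ a) :
    DifferentiableOn ℂ (reducedResolvent a c R) (ball c R) := by
  lift R to NNReal using hR.le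
  have h := (hasFPowerSeriesOn_cauchy_integral
    (circleIntegrable_resolvent hR.le hΓ) (by exact_mod_cast hR)).differentiableOn
  rwa [Metric.eball_coe] at h

lemma exists_smaller_circle (hR : 0 < R) (hΓ : sphere c R ⊆ resolventSet ℂ a) :
    ∃ r, 0 < r ∧ r < R ∧ closedBall c R \ ball c r ⊆ resolventSet ℂ a := by
  have hs : spectrum ℂ a ∩ closedBall c R ⊆ ball c R := by
    rintro z ⟨hz, hzR⟩
    rcases (mem_closedBall.1 hzR).lt_or_eq with h | h
    · exact h
    · exact absurd (hΓ h) hz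
  obtain ⟨r, ⟨hr0, hrR⟩, hr⟩ :=
    exists_pos_lt_subset_ball hR ((spectrum.isClosed a).inter isClosed_closedBall) hs
  refine ⟨r, hr0, hrR, fun z hz => ?_⟩
  by_contra h
  exact hz.2 (hr ⟨h, hz.1⟩)

/-- The spectral projection is idempotent. -/
lemma rieszProj_mul_self (hR : 0 < R) (hΓ : sphere c R ⊆ resolventSet ℂ a) :
    rieszProj a c R * rieszProj a c R = rieszProj a c R := by
  obtain ⟨r, hr0, hrR, hr⟩ := exists_smaller_circle hR hΓ
  have heq : rieszProj a c R = rieszProj a c r := by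
    unfold rieszProj
    rw [Complex.circleIntegral_eq_of_differentiable_on_annulus_off_countable hr0 hrR.le
      countable_empty ((continuousOn_resolvent a).mono hr)]
    rintro z ⟨⟨h1, h2⟩, -⟩
    exact (spectrum.hasDerivAt_resolvent_const_left (hr ⟨ball_subset_closedBall h1,
      fun h => h2 (ball_subset_closedBall h)⟩)).differentiableAt
  have hsub : sphere c r ⊆ resolventSet ℂ a := fun z hz =>
    hr ⟨(mem_closedBall.2 ((mem_sphere.1 hz).le.trans hrR.le)),
      fun h => (mem_ball.1 h).ne (mem_sphere.1 hz)⟩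
  have key : rieszProj a c r * (1 - rieszProj a c R) = 0 := by
    rw [rieszProj, smul_mul_assoc,
      circleIntegral_mul_right _ (circleIntegrable_resolvent hr0.le hsub)]
    have hcl : closedBall c r ⊆ ball c R := closedBall_subset_ball hrR
    have : (∮ z in C(c, r), resolvent a z * (1 - rieszProj a c R)) =
        ∮ z in C(c, r), reducedResolvent a c R z := by
      refine circleIntegral.integral_congr hr0.le fun z hz => ?_
      have hzb : z ∈ ball c R := hcl (sphere_subset_closedBall hz)
      have h := sub_mul_reducedResolvent (a := a) (w := z) hR.le hΓ
        (fun h => (mem_ball.1 hzb).ne (mem_sphere.1 h))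
      rw [cauchy_coeff_of_mem_ball hzb, one_smul] at h
      rw [← h, ← mul_assoc, resolvent_mul_sub (hsub hz), one_mul]
    rw [this, DiffContOnCl.circleIntegral_eq_zero hr0.le, smul_zero]
    exact DifferentiableOn.diffContOnCl ((reducedResolvent_analytic hR hΓ).mono
      (closure_ball_subset_closedBall.trans hcl))
  rw [← heq, mul_sub, mul_one, sub_eq_zero] at key
  exact key.symm

end Algebra

section Operator

variable {X : Type*} [NormedAddCommGroup X] [NormedSpace ℂ X] [CompleteSpace X]
  {T : X →L[ℂ] X} {c : ℂ} {R : ℝ}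

omit [CompleteSpace X] in
lemma algebraMap_sub_apply (T : X →L[ℂ] X) (w : ℂ) (v : X) :
    (algebraMap ℂ (X →L[ℂ] X) w - T) v = w • v - T v := rfl

omit [CompleteSpace X] in
lemma mem_spectrum_of_eigenvector {μ : ℂ} {v : X} (hv : v ≠ 0) (h : T v = μ • v) :
    μ ∈ spectrum ℂ T := by
  intro hμ
  have h1 : resolvent T μ ((algebraMap ℂ (X →L[ℂ] X) μ - T) v) = v :=
    DFunLike.congr_fun (resolvent_mul_sub hμ) v
  rw [algebraMap_sub_apply, h, sub_self, map_zero] at h1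
  exact hv h1.symm

lemma rieszProj_apply_of_mem_range (hR : 0 < R) (hΓ : sphere c R ⊆ resolventSet ℂ T) {v : X}
    (hv : v ∈ LinearMap.range ((rieszProj T c R : X →L[ℂ] X) : X →ₗ[ℂ] X)) : rieszProj T c R v = v := by
  obtain ⟨u, rfl⟩ := hv
  exact DFunLike.congr_fun (rieszProj_mul_self hR hΓ) u

/-- If the spectral projection for a circle has rank one, then the circle isolates a simple
eigenvalue. -/
theorem exists_eigenvalue_of_rank_one (hR : 0 < R) (hΓ : sphere c R ⊆ resolventSet ℂ T)
    (h1 : Module.finrank ℂ (LinearMap.range ((rieszProj T c R : X →L[ℂ] X) : X →ₗ[ℂ] X)) = 1) :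
    ∃ μ ∈ ball c R, T * rieszProj T c R = μ • rieszProj T c R ∧
      spectrum ℂ T ∩ ball c R = {μ} ∧ Module.End.HasEigenvalue (T : X →ₗ[ℂ] X) μ := by
  set P := rieszProj T c R with hP
  obtain ⟨⟨v, hv⟩, hv0, hgen⟩ := finrank_eq_one_iff'.1 h1
  have hv0' : v ≠ 0 := fun h => hv0 (Subtype.ext h)
  have hPv : P v = v := rieszProj_apply_of_mem_range hR hΓ hv
  have hcomm := rieszProj_commute hR.le hΓ
  have hTv : T v ∈ LinearMap.range (P : X →ₗ[ℂ] X) := by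
    refine ⟨T v, ?_⟩
    have : T (P v) = P (T v) := DFunLike.congr_fun hcomm v
    rw [hPv] at this
    exact this.symm
  obtain ⟨μ, hμ⟩ := hgen ⟨T v, hTv⟩
  have hμ : T v = μ • v := (congrArg Subtype.val hμ).symm
  have hμs := mem_spectrum_of_eigenvector hv0' hμ
  have hμΓ : μ ∉ sphere c R := fun h => hμs (hΓ h)
  have hμb : μ ∈ ball c R := by
    by_contra hb
    have hcb : μ ∉ closedBall c R := fun h =>
      ((mem_closedBall.1 h).lt_or_eq).elim hb hμΓ
    have e := reducedResolvent_mul_sub hR.le hΓ hμΓ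
    rw [cauchy_coeff_of_notMem hR.le hcb, ← hP, zero_smul, zero_sub] at e
    have h : reducedResolvent T c R μ ((algebraMap ℂ (X →L[ℂ] X) μ - T) v) = -P v :=
      DFunLike.congr_fun e v
    rw [algebraMap_sub_apply, hμ, sub_self, map_zero, hPv] at h
    exact hv0' (neg_eq_zero.1 h.symm)
  have hTP : T * P = μ • P := by
    ext x
    obtain ⟨α, hα⟩ := hgen ⟨P x, x, rfl⟩
    have hα : P x = α • v := (congrArg Subtype.val hα).symm
    change T (P x) = μ • P x
    rw [hα, map_smul, hμ, smul_comm]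
  refine ⟨μ, hμb, hTP, Subset.antisymm ?_ (singleton_subset_iff.2 ⟨hμs, hμb⟩), ?_⟩
  · rintro w ⟨hws, hwb⟩
    by_contra hne
    have hne' : w - μ ≠ 0 := sub_ne_zero.2 hne
    have hwΓ : w ∉ sphere c R := fun h => hws (hΓ h)
    have e1 := sub_mul_reducedResolvent hR.le hΓ hwΓ
    have e2 := reducedResolvent_mul_sub hR.le hΓ hwΓ
    rw [cauchy_coeff_of_mem_ball hwb, one_smul, ← hP] at e1 e2
    refine hws (spectrum.mem_resolventSet_of_left_right_inverse
      (b := reducedResolvent T c R w + (w - μ)⁻¹ • P)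
      (c := reducedResolvent T c R w + (w - μ)⁻¹ • P) ?_ ?_)
    · rw [mul_add, e1, mul_smul_comm, sub_mul, hTP, Algebra.algebraMap_eq_smul_one,
        smul_mul_assoc, one_mul, ← sub_smul, smul_smul, inv_mul_cancel₀ hne', one_smul,
        sub_add_cancel]
    · rw [add_mul, e2, smul_mul_assoc, mul_sub, ← hcomm, hTP, Algebra.algebraMap_eq_smul_one,
        mul_smul_comm, mul_one, ← sub_smul, smul_smul, inv_mul_cancel₀ hne', one_smul,
        sub_add_cancel]
  · exact Module.End.hasEigenvalue_of_hasEigenvector (Module.End.hasEigenvector_iff.2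
      ⟨Module.End.mem_eigenspace_iff.2 hμ, hv0'⟩)

end Operator

/-! ### Perturbation of a simple eigenvalue -/

section PerturbationAlgebra

variable {A : Type*} [NormedRing A] [NormedAlgebra ℂ A] [CompleteSpace A]
  {a b : A} {c w z : ℂ} {R M : ℝ}

lemma mem_resolventSet_of_norm_sub_le (hz : z ∈ resolventSet ℂ a) (hM : ‖resolvent a z‖ ≤ M)
    (hab : ‖a - b‖ * M ≤ 1 / 2) : z ∈ resolventSet ℂ b := by
  have hlt : ‖resolvent a z * (b - a)‖ < 1 := by
    refine (norm_mul_le _ _).trans_lt ?_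
    rw [norm_sub_rev b a, mul_comm]
    have := mul_le_mul_of_nonneg_left hM (norm_nonneg (a - b))
    linarith
  have h : algebraMap ℂ A z - b =
      (algebraMap ℂ A z - a) * (1 - resolvent a z * (b - a)) := by
    rw [mul_sub, mul_one, ← mul_assoc, sub_mul_resolvent hz, one_mul]
    abel
  change IsUnit _
  rw [h]
  exact IsUnit.mul hz (Units.oneSub _ hlt).isUnit

lemma norm_resolvent_le_of_norm_sub_le (hz : z ∈ resolventSet ℂ a) (hM : ‖resolvent a z‖ ≤ M)
    (hab : ‖a - b‖ * M ≤ 1 / 2) : ‖resolvent b z‖ ≤ 2 * M := by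
  have hb := mem_resolventSet_of_norm_sub_le hz hM hab
  have h := spectrum.resolvent_sub_resolvent hb hz
  have h1 : ‖resolvent b z‖ ≤ ‖resolvent a z‖ + ‖resolvent b z * (b - a) * resolvent a z‖ := by
    rw [← h]
    exact norm_le_norm_add_norm_sub' _ _
  have h2 : ‖resolvent b z * (b - a) * resolvent a z‖ ≤ ‖resolvent b z‖ * (1 / 2) := by
    rw [mul_assoc]
    refine (norm_mul_le _ _).trans (mul_le_mul_of_nonneg_left ?_ (norm_nonneg _))
    refine (norm_mul_le _ _).trans (le_trans ?_ hab)
    rw [norm_sub_rev]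
    exact mul_le_mul_of_nonneg_left hM (norm_nonneg _)
  linarith

lemma norm_rieszProj_sub_le (hR : 0 ≤ R) (hΓ : sphere c R ⊆ resolventSet ℂ a)
    (hM : ∀ z ∈ sphere c R, ‖resolvent a z‖ ≤ M) (hab : ‖a - b‖ * M ≤ 1 / 2) :
    ‖rieszProj b c R - rieszProj a c R‖ ≤ R * (2 * M * ‖a - b‖ * M) := by
  have hΓb : sphere c R ⊆ resolventSet ℂ b := fun z hz =>
    mem_resolventSet_of_norm_sub_le (hΓ hz) (hM z hz) hab
  rw [rieszProj, rieszProj, ← smul_sub, ← circleIntegral.integral_sub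
    (circleIntegrable_resolvent hR hΓb) (circleIntegrable_resolvent hR hΓ)]
  refine circleIntegral.norm_two_pi_i_inv_smul_integral_le_of_norm_le_const hR fun z hz => ?_
  rw [spectrum.resolvent_sub_resolvent (hΓb hz) (hΓ hz)]
  have h2 := norm_resolvent_le_of_norm_sub_le (hΓ hz) (hM z hz) hab
  have hM0 : 0 ≤ M := (norm_nonneg _).trans (hM z hz)
  refine (norm_mul_le _ _).trans (mul_le_mul ((norm_mul_le _ _).trans ?_) (hM z hz)
    (norm_nonneg _) (by positivity))
  rw [norm_sub_rev]
  exact mul_le_mul_of_nonneg_right h2 (norm_nonneg _)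

omit [CompleteSpace A] in
lemma norm_reducedResolvent_le {δ : ℝ} (hR : 0 ≤ R) (hδ : 0 < δ)
    (hM : ∀ z ∈ sphere c R, ‖resolvent a z‖ ≤ M) (hw : ∀ z ∈ sphere c R, δ ≤ ‖z - w‖) :
    ‖reducedResolvent a c R w‖ ≤ R * (δ⁻¹ * M) := by
  refine circleIntegral.norm_two_pi_i_inv_smul_integral_le_of_norm_le_const hR fun z hz => ?_
  rw [norm_smul, norm_inv]
  exact mul_le_mul (inv_anti₀ hδ (hw z hz)) (hM z hz) (norm_nonneg _) (by positivity)

end PerturbationAlgebra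

section PerturbationOperator

variable {X : Type*} [NormedAddCommGroup X] [NormedSpace ℂ X] [CompleteSpace X]

omit [CompleteSpace X] in
/-- Idempotents at distance less than one: the range of one is embedded in that of the other. -/
lemma finrank_range_le_of_norm_sub_lt_one {P Q : X →L[ℂ] X} (hQ : Q * Q = Q)
    (hPQ : ‖Q - P‖ < 1) [FiniteDimensional ℂ (LinearMap.range (P : X →ₗ[ℂ] X))] :
    FiniteDimensional ℂ (LinearMap.range (Q : X →ₗ[ℂ] X)) ∧
    Module.finrank ℂ (LinearMap.range (Q : X →ₗ[ℂ] X)) ≤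
      Module.finrank ℂ (LinearMap.range (P : X →ₗ[ℂ] X)) := by
  let f : LinearMap.range (Q : X →ₗ[ℂ] X) →ₗ[ℂ] LinearMap.range (P : X →ₗ[ℂ] X) :=
    (P : X →ₗ[ℂ] X).rangeRestrict ∘ₗ (LinearMap.range (Q : X →ₗ[ℂ] X)).subtype
  have hf : Function.Injective f := by
    rw [← LinearMap.ker_eq_bot, LinearMap.ker_eq_bot']
    rintro ⟨v, hv⟩ h
    have hPv : P v = 0 := congrArg Subtype.val h
    have hQv : Q v = v := by
      obtain ⟨u, rfl⟩ := hv
      exact DFunLike.congr_fun hQ u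
    by_contra hne
    have hv0 : 0 < ‖v‖ := norm_pos_iff.2 fun h => hne (Subtype.ext h)
    have h1 := (Q - P).le_opNorm v
    rw [show (Q - P) v = Q v - P v from rfl, hPv, hQv, sub_zero] at h1
    nlinarith
  exact ⟨FiniteDimensional.of_injective f hf, LinearMap.finrank_le_finrank_of_injective hf⟩

variable {T : X →L[ℂ] X} {c lam : ℂ} {R : ℝ}

set_option maxHeartbeats 1000000 in
/-- Quantitative perturbation of a simple eigenvalue `lam` with eigenvector `φ₀`. -/
theorem exists_perturbed_eigenvalue (hlam : lam ≠ 0) (hR : 0 < R)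
    (hΓ : sphere c R ⊆ resolventSet ℂ T) (hball : lam ∈ ball c R)
    (hTP : T * rieszProj T c R = lam • rieszProj T c R)
    (h1 : Module.finrank ℂ
      (LinearMap.range ((rieszProj T c R : X →L[ℂ] X) : X →ₗ[ℂ] X)) = 1)
    {φ₀ : X} (hφ₀ : ‖φ₀‖ = 1) (hPφ₀ : rieszProj T c R φ₀ = φ₀) :
    ∃ e₀ > 0, ∃ K ≥ 0, ∀ T' : X →L[ℂ] X, ‖T - T'‖ ≤ e₀ →
      sphere c R ⊆ resolventSet ℂ T' ∧
      Module.finrank ℂ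
        (LinearMap.range ((rieszProj T' c R : X →L[ℂ] X) : X →ₗ[ℂ] X)) = 1 ∧
      ∃ μ : ℂ, μ ≠ 0 ∧ spectrum ℂ T' ∩ ball c R = {μ} ∧
        Module.End.HasEigenvalue (T' : X →ₗ[ℂ] X) μ ∧
        ‖lam - μ‖ ≤ K * (‖T - T'‖ * ‖(T - T') φ₀‖ + ‖T ((T - T') φ₀)‖) ∧
        ∀ φ : X, φ ∈ LinearMap.range ((rieszProj T' c R : X →L[ℂ] X) : X →ₗ[ℂ] X) →
          ‖φ‖ = 1 →
          T' φ = μ • φ ∧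
          ‖φ - rieszProj T c R φ‖ ≤ K * ‖(T - T') φ₀‖ ∧
          ‖μ⁻¹ • T φ - rieszProj T c R (μ⁻¹ • T φ)‖ ≤
            K * (‖T - T'‖ * ‖(T - T') φ₀‖ + ‖T ((T - T') φ₀)‖) := by
  set P := rieszProj T c R with hP
  have hlam0 : 0 < ‖lam‖ := norm_pos_iff.2 hlam
  have hlamΓ : lam ∉ sphere c R := fun h => (mem_ball.1 hball).ne (mem_sphere.1 h)
  obtain ⟨M', hM'⟩ := (isCompact_sphere c R).exists_bound_of_continuousOn
    ((continuousOn_resolvent T).mono hΓ)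
  obtain ⟨M, hM0, hM⟩ : ∃ M > 0, ∀ z ∈ sphere c R, ‖resolvent T z‖ ≤ M :=
    ⟨max M' 1, by positivity, fun z hz => (hM' z hz).trans (le_max_left _ _)⟩
  obtain ⟨δ, hδ0, hδ⟩ : ∃ δ > 0, ∀ z ∈ sphere c R, δ ≤ ‖z - lam‖ := by
    refine ⟨R - dist lam c, sub_pos.2 (mem_ball.1 hball), fun z hz => ?_⟩
    have := dist_triangle z lam c
    rw [mem_sphere.1 hz, dist_eq_norm z lam] at this
    linarith
  set S := reducedResolvent T c R lam with hS
  set D : ℝ := R * (δ⁻¹ * (2 * M)) with hD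
  have hD0 : 0 < D := by positivity
  set B : ℝ := ‖T‖ * D + 1 with hB
  have hB0 : 0 < B := by positivity
  set K₁ : ℝ := 2 * ‖P‖ * B / ‖lam‖ with hK₁
  have hK₁0 : 0 ≤ K₁ := by positivity
  set K₂ : ℝ := (1 + ‖P‖) * D with hK₂
  have hK₂0 : 0 ≤ K₂ := by positivity
  set K₃ : ℝ := ‖S‖ * (B + K₁ * ‖T‖ * 2) with hK₃
  have hK₃0 : 0 ≤ K₃ := by positivity
  set K₄ : ℝ := 2 / ‖lam‖ * (2 * K₃) with hK₄
  have hK₄0 : 0 ≤ K₄ := by positivity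
  -- the conditions on the size of the perturbation
  obtain ⟨e₀, he₀, hc1, hc2, hc3, hc4⟩ : ∃ e₀ > 0, e₀ * M ≤ 1 / 2 ∧ R * (2 * M * e₀ * M) < 1 ∧
      D * e₀ * (‖P‖ + 1) ≤ 1 / 2 ∧ K₁ * (e₀ * e₀ + ‖T‖ * e₀) ≤ ‖lam‖ / 2 := by
    have t1 : ∀ᶠ e in nhdsWithin (0 : ℝ) (Ioi 0), e * M < 1 / 2 :=
      ((by fun_prop : Continuous fun e : ℝ => e * M).tendsto' 0 0 (by simp)).mono_left
        nhdsWithin_le_nhds |>.eventually_lt_const (by norm_num)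
    have t2 : ∀ᶠ e in nhdsWithin (0 : ℝ) (Ioi 0), R * (2 * M * e * M) < 1 :=
      ((by fun_prop : Continuous fun e : ℝ => R * (2 * M * e * M)).tendsto' 0 0
        (by simp)).mono_left nhdsWithin_le_nhds |>.eventually_lt_const (by norm_num)
    have t3 : ∀ᶠ e in nhdsWithin (0 : ℝ) (Ioi 0), D * e * (‖P‖ + 1) < 1 / 2 :=
      ((by fun_prop : Continuous fun e : ℝ => D * e * (‖P‖ + 1)).tendsto' 0 0
        (by simp)).mono_left nhdsWithin_le_nhds |>.eventually_lt_const (by norm_num)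
    have t4 : ∀ᶠ e in nhdsWithin (0 : ℝ) (Ioi 0), K₁ * (e * e + ‖T‖ * e) < ‖lam‖ / 2 :=
      ((by fun_prop : Continuous fun e : ℝ => K₁ * (e * e + ‖T‖ * e)).tendsto' 0 0
        (by simp)).mono_left nhdsWithin_le_nhds |>.eventually_lt_const (by positivity)
    obtain ⟨e, h⟩ := (t1.and (t2.and (t3.and (t4.and self_mem_nhdsWithin)))).exists
    exact ⟨e, h.2.2.2.2, h.1.le, h.2.1, h.2.2.1.le, h.2.2.2.1.le⟩
  refine ⟨e₀, he₀, K₁ + 2 * K₂ + K₄, by positivity, fun T' hT' => ?_⟩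
  set e := ‖T - T'‖ with he
  have he0 : 0 ≤ e := norm_nonneg _
  set a := ‖(T - T') φ₀‖ with ha
  have ha0 : 0 ≤ a := norm_nonneg _
  set b := ‖T ((T - T') φ₀)‖ with hb
  have hb0 : 0 ≤ b := norm_nonneg _
  have hae : a ≤ e := by
    have := (T - T').le_opNorm φ₀
    rwa [hφ₀, mul_one] at this
  have hbe : b ≤ ‖T‖ * e :=
    (T.le_opNorm _).trans (mul_le_mul_of_nonneg_left hae (norm_nonneg _))
  have heM : e * M ≤ 1 / 2 := (mul_le_mul_of_nonneg_right hT' hM0.le).trans hc1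
  have hΓ' : sphere c R ⊆ resolventSet ℂ T' := fun z hz =>
    mem_resolventSet_of_norm_sub_le (hΓ hz) (hM z hz) heM
  set P' := rieszProj T' c R with hP'
  have hPP' : ‖P' - P‖ < 1 := by
    refine (norm_rieszProj_sub_le hR.le hΓ hM heM).trans_lt (lt_of_le_of_lt ?_ hc2)
    gcongr
  have hidem := rieszProj_mul_self hR hΓ
  have hidem' := rieszProj_mul_self hR hΓ'
  have hrank : Module.finrank ℂ (LinearMap.range (P' : X →ₗ[ℂ] X)) = 1 := by
    have : FiniteDimensional ℂ (LinearMap.range (P : X →ₗ[ℂ] X)) :=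
      FiniteDimensional.of_finrank_pos (h1.symm ▸ Nat.one_pos)
    have hfin' : FiniteDimensional ℂ (LinearMap.range (P' : X →ₗ[ℂ] X)) :=
      (finrank_range_le_of_norm_sub_lt_one (P := P) hidem' hPP').1
    have hle := (finrank_range_le_of_norm_sub_lt_one (P := P) hidem' hPP').2
    have hle' := (finrank_range_le_of_norm_sub_lt_one (P := P') (Q := P) hidem
      (by rwa [norm_sub_rev])).2
    exact le_antisymm (hle.trans_eq h1) (h1.symm.trans_le hle')
  obtain ⟨μ, hμb, hTP', hspec', heig'⟩ := exists_eigenvalue_of_rank_one hR hΓ' hrank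
  rw [← hP'] at hTP'
  have hTφ₀ : T φ₀ = lam • φ₀ := by
    have h : T (P φ₀) = lam • P φ₀ := DFunLike.congr_fun hTP φ₀
    rwa [hPφ₀] at h
  -- the eigenvector of the perturbed operator
  set ψ := P' φ₀ with hψ
  have hψ' : T' ψ = μ • ψ := DFunLike.congr_fun hTP' φ₀
  have hdiff : φ₀ - ψ = reducedResolvent T' c R lam ((T - T') φ₀) := by
    have h := reducedResolvent_mul_sub hR.le hΓ' hlamΓ
    rw [cauchy_coeff_of_mem_ball hball, one_smul, ← hP'] at h
    have h2 : reducedResolvent T' c R lam ((algebraMap ℂ (X →L[ℂ] X) lam - T') φ₀) =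
        φ₀ - P' φ₀ := DFunLike.congr_fun h φ₀
    rw [algebraMap_sub_apply, ← hTφ₀] at h2
    exact h2.symm
  have hS' : ‖reducedResolvent T' c R lam‖ ≤ D :=
    norm_reducedResolvent_le hR.le hδ0
      (fun z hz => norm_resolvent_le_of_norm_sub_le (hΓ hz) (hM z hz) heM) hδ
  have hdist : ‖φ₀ - ψ‖ ≤ D * a := by
    rw [hdiff]
    exact (ContinuousLinearMap.le_opNorm _ _).trans
      (mul_le_mul_of_nonneg_right hS' ha0)
  have hsmall : D * a * (‖P‖ + 1) ≤ 1 / 2 := by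
    refine le_trans ?_ hc3
    have := hae.trans hT'
    gcongr
  have hDa : D * a ≤ 1 / 2 := by
    have : 0 ≤ D * a * ‖P‖ := by positivity
    linarith
  have hψ_lower : 1 / 2 ≤ ‖ψ‖ := by
    have := norm_sub_norm_le φ₀ ψ
    linarith
  have hψ_upper : ‖ψ‖ ≤ 2 := by
    have := norm_sub_norm_le ψ φ₀
    rw [norm_sub_rev] at this
    linarith
  have hPψ_lower : 1 / 2 ≤ ‖P ψ‖ := by
    have h2 : ‖P (φ₀ - ψ)‖ ≤ 1 / 2 := by
      refine (P.le_opNorm _).trans ?_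
      have := mul_le_mul_of_nonneg_left hdist (norm_nonneg P)
      have : 0 ≤ D * a := by positivity
      linarith
    rw [map_sub, hPφ₀] at h2
    have := norm_sub_norm_le φ₀ (P ψ)
    linarith
  -- the residual of the iterated eigenvector
  have hres_eq : μ • T ψ - T (T ψ) = T ((T - T') (φ₀ - ψ)) - T ((T - T') φ₀) := by
    rw [← map_smul, ← hψ', ← map_sub, ← map_sub, map_sub (T - T') φ₀ ψ, sub_sub_cancel_left]
    congr 1
    change T' ψ - T ψ = -(T ψ - T' ψ)
    abel
  set ρ := e * a + b with hρ
  have hρ0 : 0 ≤ ρ := by positivity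
  have hres : ‖μ • T ψ - T (T ψ)‖ ≤ B * ρ := by
    rw [hres_eq]
    have h2 : ‖T ((T - T') (φ₀ - ψ))‖ ≤ ‖T‖ * (e * (D * a)) :=
      (T.le_opNorm _).trans (mul_le_mul_of_nonneg_left
        (((T - T').le_opNorm _).trans (mul_le_mul_of_nonneg_left hdist he0)) (norm_nonneg _))
    refine (norm_sub_le _ _).trans ((add_le_add_left h2 b).trans ?_)
    have h3 : 0 ≤ ‖T‖ * D * b := by positivity
    have h4 : 0 ≤ e * a := by positivity
    calc ‖T‖ * (e * (D * a)) + b ≤ ‖T‖ * (e * (D * a)) + b + (‖T‖ * D * b + e * a) := by linarith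
      _ = B * ρ := by rw [hB, hρ]; ring
  -- the eigenvalue
  have hPT : ∀ x, P (T x) = lam • P x := fun x => by
    have h2 : T (P x) = P (T x) := DFunLike.congr_fun (rieszProj_commute hR.le hΓ) x
    rw [← h2]
    exact DFunLike.congr_fun hTP x
  have heigen : ‖lam - μ‖ ≤ K₁ * ρ := by
    have h2 : P (μ • T ψ - T (T ψ)) = ((μ - lam) * lam) • P ψ := by
      rw [map_sub, map_smul, hPT, hPT, hPT, smul_smul, smul_smul, ← sub_smul]
      ring_nf
    have h3 : ‖μ - lam‖ * ‖lam‖ * ‖P ψ‖ ≤ ‖P‖ * (B * ρ) := by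
      rw [← norm_mul, ← norm_smul, ← h2]
      exact (P.le_opNorm _).trans (mul_le_mul_of_nonneg_left hres (norm_nonneg _))
    have h4 : ‖μ - lam‖ * ‖lam‖ * (1 / 2) ≤ ‖μ - lam‖ * ‖lam‖ * ‖P ψ‖ :=
      mul_le_mul_of_nonneg_left hPψ_lower (by positivity)
    rw [norm_sub_rev, hK₁, div_mul_eq_mul_div, le_div_iff₀ hlam0]
    linarith
  have hρ_small : K₁ * ρ ≤ ‖lam‖ / 2 := by
    refine le_trans (mul_le_mul_of_nonneg_left ?_ hK₁0) hc4
    have h2 : e * a ≤ e₀ * e₀ := mul_le_mul hT' (hae.trans hT') ha0 he₀.le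
    have h3 : ‖T‖ * e ≤ ‖T‖ * e₀ := mul_le_mul_of_nonneg_left hT' (norm_nonneg _)
    linarith
  have hμ_lower : ‖lam‖ / 2 ≤ ‖μ‖ := by
    have := norm_sub_norm_le lam μ
    linarith
  have hμ0 : 0 < ‖μ‖ := by linarith
  -- the two eigenvector bounds for `ψ`
  have hψP : ‖ψ - P ψ‖ ≤ K₂ * a := by
    have h2 : ψ - P ψ = P (φ₀ - ψ) - (φ₀ - ψ) := by rw [map_sub, hPφ₀]; abel
    rw [h2]
    refine (norm_sub_le _ _).trans ?_
    have h3 := P.le_opNorm (φ₀ - ψ)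
    have h4 := mul_le_mul_of_nonneg_left hdist (norm_nonneg P)
    rw [hK₂]
    linarith
  have hTψP : ‖T ψ - P (T ψ)‖ ≤ K₃ * ρ := by
    have h := reducedResolvent_mul_sub hR.le hΓ hlamΓ
    rw [cauchy_coeff_of_mem_ball hball, one_smul, ← hP] at h
    have h2 : S ((algebraMap ℂ (X →L[ℂ] X) lam - T) (T ψ)) = T ψ - P (T ψ) :=
      DFunLike.congr_fun h (T ψ)
    have h3 : (algebraMap ℂ (X →L[ℂ] X) lam - T) (T ψ) =
        (μ • T ψ - T (T ψ)) + (lam - μ) • T ψ := by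
      rw [algebraMap_sub_apply, sub_smul]; abel
    rw [← h2, h3]
    refine (S.le_opNorm _).trans ?_
    rw [hK₃, mul_assoc]
    refine mul_le_mul_of_nonneg_left ((norm_add_le _ _).trans ?_) (norm_nonneg _)
    have h4 : ‖(lam - μ) • T ψ‖ ≤ K₁ * ρ * (‖T‖ * 2) := by
      rw [norm_smul]
      exact mul_le_mul heigen ((T.le_opNorm _).trans
        (mul_le_mul_of_nonneg_left hψ_upper (norm_nonneg _))) (norm_nonneg _) (by positivity)
    linarith
  refine ⟨hΓ', hrank, μ, norm_pos_iff.1 hμ0, hspec', heig', heigen.trans ?_, fun φ hφ hφ1 => ?_⟩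
  · refine mul_le_mul_of_nonneg_right ?_ hρ0
    linarith
  obtain ⟨α, hα⟩ : ∃ α : ℂ, φ = α • ψ := by
    obtain ⟨v, hv, hgen⟩ := finrank_eq_one_iff'.1 hrank
    obtain ⟨β, hβ⟩ := hgen ⟨ψ, φ₀, rfl⟩
    obtain ⟨γ, hγ⟩ := hgen ⟨φ, hφ⟩
    have hβ : ψ = β • (v : X) := (congrArg Subtype.val hβ).symm
    have hγ : φ = γ • (v : X) := (congrArg Subtype.val hγ).symm
    have hβ0 : β ≠ 0 := by
      rintro rfl
      rw [hβ, zero_smul, norm_zero] at hψ_lower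
      norm_num at hψ_lower
    refine ⟨γ * β⁻¹, ?_⟩
    rw [hβ, smul_smul, mul_assoc, inv_mul_cancel₀ hβ0, mul_one, hγ]
  have hα2 : ‖α‖ ≤ 2 := by
    rw [hα, norm_smul] at hφ1
    nlinarith [norm_nonneg α]
  refine ⟨by rw [hα, map_smul, hψ', smul_comm], ?_, ?_⟩
  · have h2 : φ - P φ = α • (ψ - P ψ) := by rw [hα, map_smul, smul_sub]
    rw [h2, norm_smul]
    calc ‖α‖ * ‖ψ - P ψ‖ ≤ 2 * (K₂ * a) := mul_le_mul hα2 hψP (norm_nonneg _) (by norm_num)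
      _ = 2 * K₂ * a := by ring
      _ ≤ _ := mul_le_mul_of_nonneg_right (by linarith) ha0
  · have h2 : μ⁻¹ • T φ - P (μ⁻¹ • T φ) = μ⁻¹ • α • (T ψ - P (T ψ)) := by
      rw [hα]; simp only [map_smul, smul_sub]
    rw [h2, norm_smul, norm_smul, norm_inv]
    have h3 : ‖μ‖⁻¹ ≤ 2 / ‖lam‖ := by
      rw [← inv_div]
      exact inv_anti₀ (by positivity) hμ_lower
    calc ‖μ‖⁻¹ * (‖α‖ * ‖T ψ - P (T ψ)‖) ≤ 2 / ‖lam‖ * (2 * (K₃ * ρ)) :=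
          mul_le_mul h3 (mul_le_mul hα2 hTψP (norm_nonneg _) (by norm_num)) (by positivity)
            (by positivity)
      _ = K₄ * ρ := by rw [hK₄]; ring
      _ ≤ _ := mul_le_mul_of_nonneg_right (by linarith) hρ0

end PerturbationOperator

/-! ### Regularity of integrals over triangles -/

section Regularity

lemma hasDerivAt_parametric_primitive {F W : ℝ → ℝ → ℂ} (hF : Continuous (Function.uncurry F))
    (hW : Continuous (Function.uncurry W)) (hd : ∀ s t, HasDerivAt (fun s => F s t) (W s t) s)
    (s₀ : ℝ) :
    HasDerivAt (fun s => ∫ t in (0 : ℝ)..s, F s t) (F s₀ s₀ + ∫ t in (0 : ℝ)..s₀, W s₀ t) s₀ := by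
  have hFs : ∀ s, Continuous (F s) := fun s => hF.comp (by fun_prop : Continuous fun t => (s, t))
  have hWs : ∀ s, Continuous (W s) := fun s => hW.comp (by fun_prop : Continuous fun t => (s, t))
  have d1 : ∀ s u : ℝ, HasDerivAt (fun s => ∫ t in (0 : ℝ)..u, F s t)
      (∫ t in (0 : ℝ)..u, W s t) s := by
    intro s u
    obtain ⟨B, hB⟩ := ((isCompact_Icc (a := s - 1) (b := s + 1)).prod
      (isCompact_uIcc (a := (0 : ℝ)) (b := u))).exists_bound_of_continuousOn hW.continuousOn
    refine (intervalIntegral.hasDerivAt_integral_of_dominated_loc_of_deriv_le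
      (bound := fun _ => B) (Icc_mem_nhds (by linarith : s - 1 < s) (by linarith : s < s + 1))
      ?_ ?_ ?_ ?_ ?_ ?_).2
    · exact Filter.Eventually.of_forall fun x => (hFs x).aestronglyMeasurable
    · exact (hFs s).intervalIntegrable _ _
    · exact (hWs s).aestronglyMeasurable
    · exact Filter.Eventually.of_forall fun t ht x hx => hB (x, t) ⟨hx, uIoc_subset_uIcc ht⟩
    · exact intervalIntegrable_const
    · exact Filter.Eventually.of_forall fun t ht x hx => hd x t
  have d2 : ∀ s u : ℝ, HasDerivAt (fun u => ∫ t in (0 : ℝ)..u, F s t) (F s u) u := fun s u =>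
    intervalIntegral.integral_hasDerivAt_right ((hFs s).intervalIntegrable _ _)
      ((hFs s).stronglyMeasurableAtFilter _ _) (hFs s).continuousAt
  have c1 : Continuous fun p : ℝ × ℝ => ∫ t in (0 : ℝ)..p.2, W p.1 t :=
    intervalIntegral.continuous_parametric_intervalIntegral_of_continuous
      (f := fun (p : ℝ × ℝ) t => W p.1 t)
      (hW.comp (by fun_prop : Continuous fun q : (ℝ × ℝ) × ℝ => (q.1.1, q.2))) continuous_snd
  have h := hasStrictFDerivAt_uncurry_coprod (𝕜 := ℝ) (u := (s₀, s₀))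
    (f := fun s u => ∫ t in (0 : ℝ)..u, F s t)
    (f₁ := fun s u => ContinuousLinearMap.toSpanSingleton ℝ (∫ t in (0 : ℝ)..u, W s t))
    (f₂ := fun s u => ContinuousLinearMap.toSpanSingleton ℝ (F s u))
    (Filter.Eventually.of_forall fun v => (d1 v.1 v.2).hasFDerivAt)
    (Filter.Eventually.of_forall fun v => (d2 v.1 v.2).hasFDerivAt)
    ((ContinuousLinearMap.toSpanSingletonCLE (𝕜 := ℝ) (E := ℂ)).continuous.comp c1).continuousAt
    ((ContinuousLinearMap.toSpanSingletonCLE (𝕜 := ℝ) (E := ℂ)).continuous.comp hF).continuousAt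
  have hdiag : HasDerivAt (fun s : ℝ => (s, s)) ((1 : ℝ), (1 : ℝ)) s₀ :=
    (hasDerivAt_id s₀).prodMk (hasDerivAt_id s₀)
  have h2 := h.hasFDerivAt.comp_hasDerivAt (f := fun s : ℝ => (s, s)) s₀ hdiag
  refine h2.congr_deriv ?_
  simp [ContinuousLinearMap.coprod_apply, Function.HasUncurry.uncurry, add_comm]

/-- The projection of the real line onto the unit interval. -/
def clamp (x : ℝ) : ℝ := max 0 (min x 1)

lemma continuous_clamp : Continuous clamp := by unfold clamp; fun_prop

lemma clamp_mem (x : ℝ) : clamp x ∈ Icc (0 : ℝ) 1 :=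
  ⟨le_max_left _ _, max_le zero_le_one (min_le_right _ _)⟩

lemma clamp_of_mem {x : ℝ} (hx : x ∈ Icc (0 : ℝ) 1) : clamp x = x := by
  rw [clamp, min_eq_left hx.2, max_eq_right hx.1]

lemma continuous_comp_clamp {f : ℝ → ℂ} (hf : ContinuousOn f (Icc 0 1)) :
    Continuous fun t => f (clamp t) :=
  hf.comp_continuous continuous_clamp clamp_mem

lemma continuous_triangle_extension {k : ℝ × ℝ → ℂ} (hk : ContinuousOn k lowerTriangle) :
    Continuous (Function.uncurry fun s t => k (max (clamp s) (clamp t), clamp t)) := by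
  have hc := continuous_clamp
  refine hk.comp_continuous (f := fun p : ℝ × ℝ => (max (clamp p.1) (clamp p.2), clamp p.2))
    (by fun_prop) fun p => ?_
  exact ⟨(clamp_mem _).1, le_max_right _ _, max_le (clamp_mem _).2 (clamp_mem _).2⟩

lemma convex_lowerTriangle : Convex ℝ lowerTriangle := by
  rintro ⟨x1, x2⟩ ⟨hx0, hx1, hx2⟩ ⟨y1, y2⟩ ⟨hy0, hy1, hy2⟩ a b ha hb hab
  simp only at hx0 hx1 hx2 hy0 hy1 hy2
  simp only [lowerTriangle, mem_ofPred_eq, Prod.smul_mk, Prod.mk_add_mk, smul_eq_mul]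
  refine ⟨by positivity, by gcongr, ?_⟩
  nlinarith

lemma uniqueDiffOn_lowerTriangle : UniqueDiffOn ℝ lowerTriangle := by
  refine uniqueDiffOn_convex convex_lowerTriangle ⟨((3 / 4 : ℝ), (1 / 4 : ℝ)), ?_⟩
  rw [mem_interior]
  refine ⟨{p | 0 < p.2 ∧ p.2 < p.1 ∧ p.1 < 1}, fun p hp => ⟨hp.1.le, hp.2.1.le, hp.2.2.le⟩, ?_,
    by norm_num⟩
  exact (isOpen_lt continuous_const continuous_snd).inter
    ((isOpen_lt continuous_snd continuous_fst).inter (isOpen_lt continuous_fst continuous_const))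

/-- The derivative with respect to the first variable on the lower triangle. -/
def fstDeriv (k : ℝ × ℝ → ℂ) (p : ℝ × ℝ) : ℂ := fderivWithin ℝ k lowerTriangle p (1, 0)

lemma contDiffOn_fstDeriv {m : ℕ} {k : ℝ × ℝ → ℂ}
    (hk : ContDiffOn ℝ ((m + 1 : ℕ)) k lowerTriangle) :
    ContDiffOn ℝ m (fstDeriv k) lowerTriangle :=
  (hk.fderivWithin uniqueDiffOn_lowerTriangle (by push_cast; rfl)).clm_apply contDiffOn_const

lemma hasDerivWithinAt_fst {k : ℝ × ℝ → ℂ} (hk : DifferentiableOn ℝ k lowerTriangle)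
    {s t : ℝ} (ht : 0 ≤ t) (hts : t ≤ s) (hs : s ≤ 1) :
    HasDerivWithinAt (fun s => k (s, t)) (fstDeriv k (s, t)) (Icc t 1) s := by
  have h := (hk (s, t) ⟨ht, hts, hs⟩).hasFDerivWithinAt
  have h2 : HasDerivWithinAt (fun s : ℝ => (s, t)) ((1 : ℝ), (0 : ℝ)) (Icc t 1) s :=
    ((hasDerivAt_id s).prodMk (hasDerivAt_const s t)).hasDerivWithinAt
  have hm : MapsTo (fun s : ℝ => (s, t)) (Icc t 1) lowerTriangle :=
    fun x hx => ⟨ht, hx.1, hx.2⟩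
  exact HasFDerivWithinAt.comp_hasDerivWithinAt (f := fun s : ℝ => (s, t)) s h h2 hm

lemma integral_fstDeriv {k : ℝ × ℝ → ℂ} (hk : ContDiffOn ℝ 1 k lowerTriangle)
    {s t : ℝ} (ht : 0 ≤ t) (hts : t ≤ s) (hs : s ≤ 1) :
    ∫ x in t..s, fstDeriv k (x, t) = k (s, t) - k (t, t) := by
  have hd := hk.differentiableOn one_ne_zero
  have hder : ∀ x ∈ Icc t s, HasDerivWithinAt (fun s => k (s, t)) (fstDeriv k (x, t)) (Icc t 1) x :=
    fun x hx => hasDerivWithinAt_fst hd ht hx.1 (hx.2.trans hs)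
  refine intervalIntegral.integral_eq_sub_of_hasDerivAt_of_le hts
    (f := fun s => k (s, t)) ?_ ?_ ?_
  · exact fun x hx => (hder x hx).continuousWithinAt.mono (Icc_subset_Icc_right hs)
  · exact fun x hx => (hder x (Ioo_subset_Icc_self hx)).hasDerivAt
      (Icc_mem_nhds hx.1 (hx.2.trans_le hs))
  · refine ContinuousOn.intervalIntegrable_of_Icc hts ?_
    refine (contDiffOn_fstDeriv (m := 0) hk).continuousOn.comp (by fun_prop) fun x hx => ?_
    exact ⟨ht, hx.1, hx.2.trans hs⟩

lemma hasDerivWithinAt_volterra {k : ℝ × ℝ → ℂ} {f : ℝ → ℂ}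
    (hk : ContDiffOn ℝ 1 k lowerTriangle) (hf : ContinuousOn f (Icc 0 1)) {s : ℝ}
    (hs : s ∈ Icc (0 : ℝ) 1) :
    HasDerivWithinAt (fun s => ∫ t in (0 : ℝ)..s, k (s, t) * f t)
      (k (s, s) * f s + ∫ t in (0 : ℝ)..s, fstDeriv k (s, t) * f t) (Icc 0 1) s := by
  have hcl := continuous_clamp
  set w : ℝ → ℝ → ℂ := fun s t => fstDeriv k (max (clamp s) (clamp t), clamp t) with hw
  have hwc : Continuous (Function.uncurry w) :=
    continuous_triangle_extension (contDiffOn_fstDeriv (m := 0) hk).continuousOn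
  set F : ℝ → ℝ → ℂ := fun s t => k (clamp t, clamp t) +
    ((∫ x in (0 : ℝ)..s, w x t) - ∫ x in (0 : ℝ)..clamp t, w x t) with hF
  have hwt : ∀ t, Continuous fun x => w x t := fun t =>
    hwc.comp (by fun_prop : Continuous fun x => (x, t))
  have hdiag : Continuous fun t => k (clamp t, clamp t) :=
    hk.continuousOn.comp_continuous (f := fun t => (clamp t, clamp t)) (by fun_prop) fun t =>
      ⟨(clamp_mem t).1, le_rfl, (clamp_mem t).2⟩
  have hFc : Continuous (Function.uncurry F) := by
    refine (hdiag.comp continuous_snd).add (Continuous.sub ?_ ?_)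
    · exact intervalIntegral.continuous_parametric_intervalIntegral_of_continuous
        (f := fun (p : ℝ × ℝ) x => w x p.2)
        (hwc.comp (by fun_prop : Continuous fun q : (ℝ × ℝ) × ℝ => (q.2, q.1.2))) continuous_fst
    · exact intervalIntegral.continuous_parametric_intervalIntegral_of_continuous
        (f := fun (p : ℝ × ℝ) x => w x p.2)
        (hwc.comp (by fun_prop : Continuous fun q : (ℝ × ℝ) × ℝ => (q.2, q.1.2)))
        (hcl.comp continuous_snd)
  have hFd : ∀ s t, HasDerivAt (fun s => F s t) (w s t) s := fun s t => by
    have := intervalIntegral.integral_hasDerivAt_right (a := 0) (b := s)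
      ((hwt t).intervalIntegrable _ _) ((hwt t).stronglyMeasurableAtFilter _ _) (hwt t).continuousAt
    exact (this.sub_const _).const_add _
  have hFk : ∀ s t : ℝ, 0 ≤ t → t ≤ s → s ≤ 1 → F s t = k (s, t) := fun s t h0 hts h1 => by
    have ht : clamp t = t := clamp_of_mem ⟨h0, hts.trans h1⟩
    have e : ∫ x in t..s, w x t = ∫ x in t..s, fstDeriv k (x, t) := by
      refine intervalIntegral.integral_congr fun x hx => ?_
      rw [uIcc_of_le hts] at hx
      simp only [hw, ht, clamp_of_mem (⟨h0.trans hx.1, hx.2.trans h1⟩ : x ∈ Icc (0 : ℝ) 1),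
        max_eq_left hx.1]
    simp only [hF, ht]
    rw [intervalIntegral.integral_interval_sub_left ((hwt t).intervalIntegrable _ _)
      ((hwt t).intervalIntegrable _ _), e, integral_fstDeriv hk h0 hts h1]
    ring
  have hft := continuous_comp_clamp hf
  have key := hasDerivAt_parametric_primitive
    (F := fun s t => F s t * f (clamp t)) (W := fun s t => w s t * f (clamp t))
    (hFc.mul (hft.comp continuous_snd)) (hwc.mul (hft.comp continuous_snd))
    (fun s t => (hFd s t).mul_const _) s
  have hG : ∀ u ∈ Icc (0 : ℝ) 1, ∫ t in (0 : ℝ)..u, k (u, t) * f t =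
      ∫ t in (0 : ℝ)..u, F u t * f (clamp t) := fun u hu => by
    refine intervalIntegral.integral_congr fun t ht => ?_
    rw [uIcc_of_le hu.1] at ht
    simp only [hFk u t ht.1 ht.2 hu.2, clamp_of_mem (⟨ht.1, ht.2.trans hu.2⟩ : t ∈ Icc (0 : ℝ) 1)]
  refine (key.hasDerivWithinAt.congr hG (hG s hs)).congr_deriv ?_
  rw [hFk s s hs.1 le_rfl hs.2, clamp_of_mem hs]
  congr 1
  refine intervalIntegral.integral_congr fun t ht => ?_
  rw [uIcc_of_le hs.1] at ht
  simp only [hw, clamp_of_mem hs, clamp_of_mem (⟨ht.1, ht.2.trans hs.2⟩ : t ∈ Icc (0 : ℝ) 1),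
    max_eq_left ht.2]

lemma continuousOn_volterra {k : ℝ × ℝ → ℂ} {f : ℝ → ℂ}
    (hk : ContinuousOn k lowerTriangle) (hf : ContinuousOn f (Icc 0 1)) :
    ContinuousOn (fun s => ∫ t in (0 : ℝ)..s, k (s, t) * f t) (Icc 0 1) := by
  have h := intervalIntegral.continuous_parametric_intervalIntegral_of_continuous (μ := volume)
    (a₀ := 0)
    (f := fun (s : ℝ) t => k (max (clamp s) (clamp t), clamp t) * f (clamp t))
    ((continuous_triangle_extension hk).mul ((continuous_comp_clamp hf).comp continuous_snd))
    continuous_id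
  refine h.continuousOn.congr fun s hs => ?_
  refine intervalIntegral.integral_congr fun t ht => ?_
  rw [uIcc_of_le hs.1] at ht
  simp only [clamp_of_mem hs, clamp_of_mem (⟨ht.1, ht.2.trans hs.2⟩ : t ∈ Icc (0 : ℝ) 1),
    max_eq_left ht.2]

/-- A Volterra operator with a kernel of class `C^m` gains one derivative. -/
theorem contDiffOn_volterra (m : ℕ) : ∀ {k : ℝ × ℝ → ℂ} {f : ℝ → ℂ},
    ContDiffOn ℝ m k lowerTriangle → ContDiffOn ℝ (m - 1 : ℕ) f (Icc 0 1) →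
    ContDiffOn ℝ m (fun s => ∫ t in (0 : ℝ)..s, k (s, t) * f t) (Icc 0 1) := by
  induction m with
  | zero =>
    intro k f hk hf
    exact contDiffOn_zero.2 (continuousOn_volterra hk.continuousOn hf.continuousOn)
  | succ m ih =>
    intro k f hk hf
    rw [Nat.add_sub_cancel] at hf
    have hd := fun s (hs : s ∈ Icc (0 : ℝ) 1) => hasDerivWithinAt_volterra
      (hk.of_le (by exact_mod_cast Nat.le_add_left 1 m)) hf.continuousOn hs
    have hu := uniqueDiffOn_Icc (zero_lt_one (α := ℝ))
    push_cast
    rw [contDiffOn_succ_iff_derivWithin hu]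
    refine ⟨fun s hs => (hd s hs).differentiableWithinAt, by simp, ?_⟩
    refine ContDiffOn.congr (ContDiffOn.add (ContDiffOn.mul ?_ hf)
      (ih (contDiffOn_fstDeriv hk) (hf.of_le ?_))) fun s hs => (hd s hs).derivWithin (hu s hs)
    · exact (hk.of_le (by exact_mod_cast Nat.le_succ m)).comp
        (by fun_prop : ContDiffOn ℝ m (fun s : ℝ => (s, s)) (Icc 0 1))
        fun s hs => ⟨hs.1, le_rfl, hs.2⟩
    · exact_mod_cast Nat.sub_le m 1

lemma mapsTo_one_sub_Icc : MapsTo (fun s : ℝ => 1 - s) (Icc 0 1) (Icc 0 1) :=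
  fun s hs => ⟨by linarith [hs.2], by linarith [hs.1]⟩

theorem contDiffOn_volterra_upper (m : ℕ) {k : ℝ × ℝ → ℂ} {f : ℝ → ℂ}
    (hk : ContDiffOn ℝ m k upperTriangle) (hf : ContDiffOn ℝ (m - 1 : ℕ) f (Icc 0 1)) :
    ContDiffOn ℝ m (fun s => ∫ t in s..(1 : ℝ), k (s, t) * f t) (Icc 0 1) := by
  have hk' : ContDiffOn ℝ m (fun p : ℝ × ℝ => k (1 - p.1, 1 - p.2)) lowerTriangle :=
    hk.comp (by fun_prop : ContDiffOn ℝ m (fun p : ℝ × ℝ => (1 - p.1, 1 - p.2)) lowerTriangle)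
      fun p hp => ⟨by linarith [hp.2.2], by linarith [hp.2.1], by linarith [hp.1]⟩
  have hf' : ContDiffOn ℝ (m - 1 : ℕ) (fun t => f (1 - t)) (Icc 0 1) :=
    hf.comp (by fun_prop : ContDiffOn ℝ (m - 1 : ℕ) (fun s : ℝ => 1 - s) (Icc 0 1))
      mapsTo_one_sub_Icc
  refine ((contDiffOn_volterra m hk' hf').comp
    (by fun_prop : ContDiffOn ℝ m (fun s : ℝ => 1 - s) (Icc 0 1)) mapsTo_one_sub_Icc).congr
    fun s hs => ?_
  have := intervalIntegral.integral_comp_sub_left (a := 0) (b := 1 - s)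
    (fun t => k (s, t) * f t) 1
  simp only [Function.comp, sub_sub_cancel, sub_zero] at this ⊢
  exact this.symm

/-- Eigenfunctions inherit the regularity of the kernel. -/
theorem contDiffOn_of_eigen {m : ℕ} {k₁ k₂ : ℝ × ℝ → ℂ} {f : ℝ → ℂ} {lam : ℂ} (hlam : lam ≠ 0)
    (hk₁ : ContDiffOn ℝ m k₁ lowerTriangle) (hk₂ : ContDiffOn ℝ m k₂ upperTriangle)
    (hf : ContinuousOn f (Icc 0 1))
    (h : ∀ s ∈ Icc (0 : ℝ) 1, lam * f s =
      (∫ t in (0 : ℝ)..s, k₁ (s, t) * f t) + ∫ t in s..(1 : ℝ), k₂ (s, t) * f t) :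
    ContDiffOn ℝ m f (Icc 0 1) := by
  have key : ∀ j : ℕ, j ≤ m → ContDiffOn ℝ j f (Icc 0 1) := by
    intro j
    induction j with
    | zero => exact fun _ => contDiffOn_zero.2 hf
    | succ j ih =>
      intro hj
      have hjm : ((j + 1 : ℕ) : WithTop ℕ∞) ≤ m := by exact_mod_cast hj
      have h1 := contDiffOn_volterra (j + 1) (hk₁.of_le hjm) (ih (by omega))
      have h2 := contDiffOn_volterra_upper (j + 1) (hk₂.of_le hjm) (ih (by omega))
      refine ((h1.add h2).const_smul lam⁻¹).congr fun s hs => ?_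
      rw [← h s hs, smul_eq_mul, inv_mul_cancel_left₀ hlam]
  exact key m le_rfl

/-- Taylor approximation from the right, with uniform bounds for all base points. -/
theorem exists_uniform_taylor (m : ℕ) : ∀ {f : ℝ → ℂ}, ContDiffOn ℝ m f (Icc 0 1) →
    ∃ M : ℝ, 0 ≤ M ∧ ∀ a ∈ Icc (0 : ℝ) 1, ∃ c : ℕ → ℂ, (∀ i, ‖c i‖ ≤ M) ∧
      ∀ t ∈ Icc a 1, ‖f t - ∑ i ∈ Finset.range m, c i * ((t - a : ℝ) : ℂ) ^ i‖
        ≤ M * (t - a) ^ m := by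
  induction m with
  | zero =>
    intro f hf
    obtain ⟨M, hM⟩ := isCompact_Icc.exists_bound_of_continuousOn hf.continuousOn
    refine ⟨max M 0, le_max_right _ _, fun a ha => ⟨0, by simp, fun t ht => ?_⟩⟩
    simpa using Or.inl (hM t ⟨ha.1.trans ht.1, ht.2⟩)
  | succ m ih =>
    intro f hf
    have hu := uniqueDiffOn_Icc (zero_lt_one (α := ℝ))
    obtain ⟨B, hB⟩ := isCompact_Icc.exists_bound_of_continuousOn hf.continuousOn
    push_cast at hf
    rw [contDiffOn_succ_iff_derivWithin hu] at hf
    obtain ⟨hd, -, hf'⟩ := hf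
    obtain ⟨M, hM0, hM⟩ := ih hf'
    refine ⟨max M B, le_max_of_le_left hM0, fun a ha => ?_⟩
    obtain ⟨c, hc, hct⟩ := hM a ha
    refine ⟨fun i => Nat.casesOn i (f a) fun j => c j / (j + 1), ?_, fun t ht => ?_⟩
    · rintro (_ | j)
      · exact (hB a ha).trans (le_max_right _ _)
      · refine le_trans ?_ ((hc j).trans (le_max_left _ _))
        simp only [norm_div]
        refine div_le_self (norm_nonneg _) ?_
        have : ‖((j : ℂ) + 1)‖ = (j : ℝ) + 1 := by exact_mod_cast Complex.norm_natCast (j + 1)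
        rw [this]
        linarith [(Nat.cast_nonneg j : (0 : ℝ) ≤ j)]
    · have hder : ∀ x ∈ Icc a t, HasDerivWithinAt
          (fun x : ℝ => f x - ∑ j ∈ Finset.range m,
            c j / (j + 1) * ((x - a : ℝ) : ℂ) ^ (j + 1))
          (derivWithin f (Icc 0 1) x - ∑ j ∈ Finset.range m, c j * ((x - a : ℝ) : ℂ) ^ j)
          (Icc a t) x := by
        intro x hx
        have h1 : HasDerivWithinAt f (derivWithin f (Icc 0 1) x) (Icc a t) x :=
          (hd x ⟨ha.1.trans hx.1, hx.2.trans ht.2⟩).hasDerivWithinAt.mono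
            (Icc_subset_Icc ha.1 ht.2)
        refine h1.sub (HasDerivAt.hasDerivWithinAt (HasDerivAt.fun_sum fun j _ => ?_))
        have h2 : HasDerivAt (fun x : ℝ => ((x - a : ℝ) : ℂ)) 1 x :=
          ((hasDerivAt_id x).sub_const a).ofReal_comp
        refine ((h2.pow (j + 1)).const_mul (c j / (j + 1))).congr_deriv ?_
        have : (j : ℂ) + 1 ≠ 0 := by exact_mod_cast Nat.succ_ne_zero j
        field_simp
        push_cast
        ring
      have hbd : ∀ x ∈ Icc a t, ‖derivWithin f (Icc 0 1) x -
          ∑ j ∈ Finset.range m, c j * ((x - a : ℝ) : ℂ) ^ j‖ ≤ M * (t - a) ^ m := by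
        intro x hx
        refine (hct x ⟨hx.1, hx.2.trans ht.2⟩).trans ?_
        have h0 : 0 ≤ x - a := sub_nonneg.2 hx.1
        have h1 : x - a ≤ t - a := sub_le_sub_right hx.2 a
        gcongr
      have h3 := (convex_Icc a t).norm_image_sub_le_of_norm_hasDerivWithin_le hder hbd
        (left_mem_Icc.2 ht.1) (right_mem_Icc.2 ht.1)
      have e1 : ∀ x : ℝ, ∑ i ∈ Finset.range (m + 1), (Nat.casesOn i (f a)
          fun j => c j / (j + 1) : ℂ) * ((x - a : ℝ) : ℂ) ^ i =
          (∑ j ∈ Finset.range m, c j / (j + 1) * ((x - a : ℝ) : ℂ) ^ (j + 1)) + f a := by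
        intro x
        rw [Finset.sum_range_succ']
        simp
      have e2 : ∑ j ∈ Finset.range m, c j / (j + 1) * ((a - a : ℝ) : ℂ) ^ (j + 1) = 0 := by
        simp
      rw [e1]
      rw [e2, sub_zero, sub_sub, Real.norm_of_nonneg (sub_nonneg.2 ht.1), mul_assoc,
        ← pow_succ] at h3
      refine h3.trans (mul_le_mul_of_nonneg_right (le_max_left _ _) ?_)
      exact pow_nonneg (sub_nonneg.2 ht.1) _

end Regularity

/-! ### Interpolation on a reference interval -/

section Interpolation

lemma relNode_injective (r : ℕ) : Function.Injective (relNode r) := by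
  intro i k h
  unfold relNode at h
  split_ifs at h with hr
  · subst hr
    exact Subsingleton.elim (α := Fin 1) i k
  · have hr : (2 * r : ℝ) ≠ 0 := by positivity
    rw [div_left_inj' hr] at h
    exact Fin.ext (by exact_mod_cast h)

lemma relNode_rev (r : ℕ) (i : Fin (2 * r + 1)) : relNode r i.rev = 1 - relNode r i := by
  unfold relNode
  split_ifs with hr
  · norm_num
  · have hr : (2 * r : ℝ) ≠ 0 := by positivity
    have hi : (i : ℕ) + 1 ≤ 2 * r + 1 := i.2
    rw [Fin.val_rev, Nat.cast_sub hi]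
    push_cast
    field_simp
    ring

/-- The Lagrange basis polynomials of the reference interval. -/
def refBasis (r : ℕ) (i : Fin (2 * r + 1)) (u : ℝ) : ℝ :=
  (Lagrange.basis Finset.univ (relNode r) i).eval u

/-- The node polynomial of the reference interval. -/
def refNodal (r : ℕ) (u : ℝ) : ℝ := (Lagrange.nodal Finset.univ (relNode r)).eval u

lemma continuous_refBasis (r : ℕ) (i : Fin (2 * r + 1)) : Continuous (refBasis r i) := by
  unfold refBasis; fun_prop

lemma continuous_refNodal (r : ℕ) : Continuous (refNodal r) := by
  unfold refNodal; fun_prop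

lemma sum_mul_refBasis (r : ℕ) {p : Polynomial ℝ} (hp : p.degree < ((2 * r + 1 : ℕ) : WithBot ℕ)) (u : ℝ) :
    ∑ i, p.eval (relNode r i) * refBasis r i u = p.eval u := by
  have h := Lagrange.eq_interpolate (s := Finset.univ) (f := p)
    (relNode_injective r).injOn (by simpa using hp)
  have h2 := congrArg (Polynomial.eval u) h.symm
  simpa [Lagrange.interpolate_apply, Polynomial.eval_finsetSum, refBasis] using h2

lemma sum_pow_mul_refBasis (r : ℕ) {m : ℕ} (hm : m < 2 * r + 1) (u : ℝ) :
    ∑ i, relNode r i ^ m * refBasis r i u = u ^ m := by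
  have h := sum_mul_refBasis r (p := Polynomial.X ^ m)
    (by rw [Polynomial.degree_X_pow]; exact_mod_cast hm) u
  simpa using h

lemma sum_top_pow_mul_refBasis (r : ℕ) (u : ℝ) :
    ∑ i, relNode r i ^ (2 * r + 1) * refBasis r i u = u ^ (2 * r + 1) - refNodal r u := by
  have hdeg : (Polynomial.X ^ (2 * r + 1) - Lagrange.nodal Finset.univ (relNode r)).degree
      < ((2 * r + 1 : ℕ) : WithBot ℕ) := by
    have hX : (Polynomial.X ^ (2 * r + 1) : Polynomial ℝ).degree = (2 * r + 1 : ℕ) :=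
      Polynomial.degree_X_pow _
    rw [← hX]
    refine Polynomial.degree_sub_lt_left ?_ (pow_ne_zero _ Polynomial.X_ne_zero) ?_
    · rw [hX, Lagrange.degree_nodal]; simp
    · rw [(Polynomial.monic_X_pow _).leadingCoeff, Lagrange.nodal_monic.leadingCoeff]
  have h := sum_mul_refBasis r hdeg u
  rw [Polynomial.eval_sub, Polynomial.eval_pow, Polynomial.eval_X] at h
  rw [refNodal, ← h]
  refine Finset.sum_congr rfl fun i _ => ?_
  rw [Polynomial.eval_sub, Lagrange.eval_nodal_at_node (Finset.mem_univ i)]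
  simp

lemma exists_lebesgue_const (r : ℕ) :
    ∃ Λ : ℝ, 0 ≤ Λ ∧ ∀ u ∈ Icc (0 : ℝ) 1, ∑ i, |refBasis r i u| ≤ Λ := by
  obtain ⟨B, hB⟩ := isCompact_Icc.exists_bound_of_continuousOn (s := Icc (0 : ℝ) 1)
    (f := fun u => ∑ i, |refBasis r i u|)
    (continuous_finsetSum _ fun i _ => (continuous_refBasis r i).abs).continuousOn
  exact ⟨max B 0, le_max_right _ _, fun u hu =>
    (le_abs_self _).trans ((hB u hu).trans (le_max_left _ _))⟩

lemma abs_refNodal_le (r : ℕ) {u : ℝ} (hu : u ∈ Icc (0 : ℝ) 1) : |refNodal r u| ≤ 1 := by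
  rw [refNodal, Lagrange.eval_nodal, Finset.abs_prod]
  refine Finset.prod_le_one (fun _ _ => abs_nonneg _) fun i _ => ?_
  obtain ⟨h0, h1⟩ := relNode_mem r i
  rw [abs_le]
  constructor <;> linarith [hu.1, hu.2]

lemma refNodal_one_sub (r : ℕ) (u : ℝ) : refNodal r (1 - u) = -refNodal r u := by
  simp only [refNodal, Lagrange.eval_nodal]
  rw [← Equiv.prod_comp Fin.revPerm fun i => 1 - u - relNode r i]
  have : ∀ i : Fin (2 * r + 1), 1 - u - relNode r (Fin.revPerm i) = -1 * (u - relNode r i) :=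
    fun i => by rw [Fin.revPerm_apply, relNode_rev]; ring
  simp only [this]
  rw [Finset.prod_mul_distrib, Finset.prod_const, Finset.card_univ, Fintype.card_fin,
    Odd.neg_one_pow (odd_two_mul_add_one r), neg_one_mul]

lemma integral_refNodal (r : ℕ) : ∫ u in (0 : ℝ)..1, refNodal r u = 0 := by
  have h := intervalIntegral.integral_comp_sub_left (a := 0) (b := 1) (refNodal r) 1
  simp only [refNodal_one_sub, sub_self, sub_zero, intervalIntegral.integral_neg] at h
  linarith

/-- The interpolation error at `u` of a function that is within `ε` of a polynomial of degree
`2r+1` is, up to a multiple of `ε`, that of the leading term. -/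
lemma norm_interpolation_error_le {r : ℕ} {Λ ε : ℝ} (hΛ : ∀ u ∈ Icc (0 : ℝ) 1,
    ∑ i, |refBasis r i u| ≤ Λ) {g : ℝ → ℂ} {c : ℕ → ℂ} (hε : 0 ≤ ε)
    (hg : ∀ u ∈ Icc (0 : ℝ) 1,
      ‖g u - ∑ m ∈ Finset.range (2 * r + 2), c m * (u : ℂ) ^ m‖ ≤ ε)
    {u : ℝ} (hu : u ∈ Icc (0 : ℝ) 1) :
    ‖g u - ∑ i, g (relNode r i) * (refBasis r i u : ℂ) - c (2 * r + 1) * (refNodal r u : ℂ)‖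
      ≤ (1 + Λ) * ε := by
  set p : ℝ → ℂ := fun u => ∑ m ∈ Finset.range (2 * r + 2), c m * (u : ℂ) ^ m with hp
  have hpoly : ∑ i, p (relNode r i) * (refBasis r i u : ℂ) =
      p u - c (2 * r + 1) * (refNodal r u : ℂ) := by
    have e1 : ∑ i, p (relNode r i) * (refBasis r i u : ℂ) =
        ∑ m ∈ Finset.range (2 * r + 2),
          c m * ((∑ i, relNode r i ^ m * refBasis r i u : ℝ) : ℂ) := by
      simp only [hp, Finset.sum_mul]
      rw [Finset.sum_comm]
      refine Finset.sum_congr rfl fun m _ => ?_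
      push_cast
      rw [Finset.mul_sum]
      exact Finset.sum_congr rfl fun i _ => by ring
    rw [e1]
    simp only [hp]
    rw [Finset.sum_range_succ _ (2 * r + 1), Finset.sum_range_succ _ (2 * r + 1),
      sum_top_pow_mul_refBasis]
    have e2 : ∑ m ∈ Finset.range (2 * r + 1),
        c m * ((∑ i, relNode r i ^ m * refBasis r i u : ℝ) : ℂ) =
        ∑ m ∈ Finset.range (2 * r + 1), c m * (u : ℂ) ^ m := by
      refine Finset.sum_congr rfl fun m hm => ?_
      rw [sum_pow_mul_refBasis r (Finset.mem_range.1 hm)]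
      push_cast
      rfl
    rw [e2]
    push_cast
    ring
  have e : g u - ∑ i, g (relNode r i) * (refBasis r i u : ℂ) - c (2 * r + 1) * (refNodal r u : ℂ)
      = (g u - p u) - ∑ i, (g (relNode r i) - p (relNode r i)) * (refBasis r i u : ℂ) := by
    simp only [sub_mul, Finset.sum_sub_distrib, hpoly]
    ring
  rw [e]
  have h2 : ‖∑ i, (g (relNode r i) - p (relNode r i)) * (refBasis r i u : ℂ)‖ ≤ Λ * ε := by
    refine (norm_sum_le _ _).trans ?_
    refine le_trans ?_ (mul_le_mul_of_nonneg_right (hΛ u hu) hε)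
    rw [Finset.sum_mul]
    refine Finset.sum_le_sum fun i _ => ?_
    rw [norm_mul, Complex.norm_real, Real.norm_eq_abs, mul_comm]
    exact mul_le_mul_of_nonneg_left (hg _ (relNode_mem r i)) (abs_nonneg _)
  refine (norm_sub_le _ _).trans ?_
  linarith [hg u hu]

end Interpolation

/-! ### The interpolatory projection -/

section Projection

variable {r n : ℕ}

lemma eval_basis_node (hn : 0 < n) (j : Fin n) (i : Fin (2 * r + 1)) (t : ℝ) :
    (Lagrange.basis Finset.univ (node r n j) i).eval t = refBasis r i (n * t - j) := by
  have hn' : (n : ℝ) ≠ 0 := by positivity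
  rw [refBasis, Lagrange.basis, Lagrange.basis, Polynomial.eval_prod, Polynomial.eval_prod]
  refine Finset.prod_congr rfl fun k hk => ?_
  simp only [Lagrange.basisDivisor, Polynomial.eval_mul, Polynomial.eval_C, Polynomial.eval_sub,
    Polynomial.eval_X, node]
  have h1 : ((j : ℝ) + relNode r i) / n - (j + relNode r k) / n =
      (relNode r i - relNode r k) / n := by ring
  have h2 : t - ((j : ℝ) + relNode r k) / n = (n * t - j - relNode r k) / n := by
    field_simp
    ring
  rw [h1, h2, inv_div]
  field_simp

/-- The piecewise polynomial interpolant, as a function. -/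
def interpFun (r n : ℕ) (x : C(I, ℂ)) (t : I) : ℂ :=
  ∑ j : Fin n, ∑ i : Fin (2 * r + 1), x ⟨node r n j i, node_mem r n j i⟩ * basisFun r n j i t

lemma coeFn_interpOp (r n : ℕ) (x : C(I, ℂ)) : interpOp r n x =ᵐ[volume] interpFun r n x := by
  have h : interpOp r n x = ∑ p : Fin n × Fin (2 * r + 1),
      x ⟨node r n p.1 p.2, node_mem r n p.1 p.2⟩ •
        (basisFun_memLp r n p.1 p.2).toLp (basisFun r n p.1 p.2) := by
    rw [Fintype.sum_prod_type, interpOp]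
    simp
  rw [h]
  refine (Lp.coeFn_finsetSum _ _).trans ?_
  have h2 : ∀ᵐ t : I, ∀ p : Fin n × Fin (2 * r + 1),
      (x ⟨node r n p.1 p.2, node_mem r n p.1 p.2⟩ •
        (basisFun_memLp r n p.1 p.2).toLp (basisFun r n p.1 p.2) : Linf) t =
      x ⟨node r n p.1 p.2, node_mem r n p.1 p.2⟩ * basisFun r n p.1 p.2 t := by
    rw [ae_all_iff]
    intro p
    filter_upwards [Lp.coeFn_smul (x ⟨node r n p.1 p.2, node_mem r n p.1 p.2⟩)
      ((basisFun_memLp r n p.1 p.2).toLp (basisFun r n p.1 p.2)),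
      (basisFun_memLp r n p.1 p.2).coeFn_toLp] with t h3 h4
    rw [h3, Pi.smul_apply, h4, smul_eq_mul]
  filter_upwards [h2] with t ht
  simp only [Finset.sum_apply, ht]
  rw [Fintype.sum_prod_type]
  rfl

/-- The `j`-th subinterval `(j/n, (j+1)/n]`. -/
def cell (n j : ℕ) : Set I := {t : I | (t : ℝ) ∈ Ioc ((j : ℝ) / n) ((j + 1 : ℝ) / n)}

lemma mem_cell_iff (hn : 0 < n) {j : ℕ} {t : I} :
    t ∈ cell n j ↔ 0 < n * (t : ℝ) - j ∧ n * (t : ℝ) - j ≤ 1 := by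
  have hn' : (0 : ℝ) < n := by exact_mod_cast hn
  rw [cell, mem_ofPred_eq, mem_Ioc, div_lt_iff₀ hn', le_div_iff₀ hn']
  constructor <;> rintro ⟨h1, h2⟩ <;> constructor <;> linarith

lemma cell_unique (hn : 0 < n) {j k : ℕ} {t : I} (hj : t ∈ cell n j) (hk : t ∈ cell n k) :
    j = k := by
  rw [mem_cell_iff hn] at hj hk
  have h1 : (j : ℝ) < k + 1 := by linarith
  have h2 : (k : ℝ) < j + 1 := by linarith
  have h1 : j < k + 1 := by exact_mod_cast h1
  have h2 : k < j + 1 := by exact_mod_cast h2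
  omega

lemma exists_mem_cell (hn : 0 < n) {t : I} (ht : t ≠ 0) : ∃ j : Fin n, t ∈ cell n j := by
  have hn' : (0 : ℝ) < n := by exact_mod_cast hn
  have ht0 : (0 : ℝ) < t := unitInterval.pos_iff_ne_zero.2 ht
  have hpos : 0 < (n : ℝ) * t := by positivity
  have hc : 0 < ⌈(n : ℝ) * t⌉₊ := Nat.ceil_pos.2 hpos
  have hle : ⌈(n : ℝ) * t⌉₊ ≤ n := Nat.ceil_le.2 (by nlinarith [t.2.2])
  have hlt := Nat.ceil_lt_add_one hpos.le
  have hge := Nat.le_ceil ((n : ℝ) * t)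
  refine ⟨⟨⌈(n : ℝ) * t⌉₊ - 1, by omega⟩, (mem_cell_iff hn).2 ?_⟩
  rw [Nat.cast_sub hc, Nat.cast_one]
  constructor <;> linarith

lemma interpFun_of_mem_cell (hn : 0 < n) (x : C(I, ℂ)) {j : Fin n} {t : I} (ht : t ∈ cell n j) :
    interpFun r n x t = ∑ i : Fin (2 * r + 1),
      x ⟨node r n j i, node_mem r n j i⟩ * (refBasis r i (n * (t : ℝ) - j) : ℂ) := by
  rw [interpFun, Finset.sum_eq_single j]
  · refine Finset.sum_congr rfl fun i _ => ?_
    rw [basisFun, indicator_of_mem (by exact ht), eval_basis_node hn]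
  · intro k _ hk
    refine Finset.sum_eq_zero fun i _ => ?_
    rw [basisFun, indicator_of_notMem, mul_zero]
    exact fun h => hk (Fin.ext (cell_unique hn h ht))
  · simp

/-- The interpolation error on a subinterval. -/
lemma norm_sub_interpFun_le {Λ ε : ℝ} (hΛ : ∀ u ∈ Icc (0 : ℝ) 1, ∑ i, |refBasis r i u| ≤ Λ)
    (hn : 0 < n) (x : C(I, ℂ)) (j : Fin n) {c : ℕ → ℂ} (hε : 0 ≤ ε)
    (hx : ∀ t : I, 0 ≤ n * (t : ℝ) - j → n * (t : ℝ) - j ≤ 1 →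
      ‖x t - ∑ m ∈ Finset.range (2 * r + 2), c m * ((n * (t : ℝ) - j : ℝ) : ℂ) ^ m‖ ≤ ε)
    {t : I} (ht : t ∈ cell n j) :
    ‖x t - interpFun r n x t - c (2 * r + 1) * (refNodal r (n * (t : ℝ) - j) : ℂ)‖
      ≤ (1 + Λ) * ε := by
  have hn' : (0 : ℝ) < n := by exact_mod_cast hn
  have hjn : (j : ℝ) + 1 ≤ n := by exact_mod_cast j.2
  have hmem : ∀ u ∈ Icc (0 : ℝ) 1, (j + u) / n ∈ Icc (0 : ℝ) 1 := fun u hu =>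
    ⟨by have := hu.1; positivity, by rw [div_le_one hn']; linarith [hu.2]⟩
  obtain ⟨h0, h1⟩ := (mem_cell_iff hn).1 ht
  have hinv : ∀ u : ℝ, n * ((j + u) / n) - j = u := fun u => by field_simp; ring
  set g : ℝ → ℂ := fun u => x (projIcc 0 1 zero_le_one ((j + u) / n)) with hg
  have hgt : g (n * (t : ℝ) - j) = x t := by
    have : ((j : ℝ) + (n * (t : ℝ) - j)) / n = t := by field_simp; ring
    simp only [hg, this, projIcc_val]
  have hgn : ∀ i, g (relNode r i) = x ⟨node r n j i, node_mem r n j i⟩ := fun i => by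
    simp only [hg, projIcc_of_mem zero_le_one (hmem _ (relNode_mem r i))]
    rfl
  have key := norm_interpolation_error_le (g := g) (c := c) hΛ hε (fun u hu => by
    have := hx ⟨(j + u) / n, hmem u hu⟩
    simp only [hinv] at this
    simpa only [hg, projIcc_of_mem zero_le_one (hmem u hu)] using this hu.1 hu.2)
    (u := n * (t : ℝ) - j) ⟨h0.le, h1⟩
  rw [interpFun_of_mem_cell hn x ht]
  simpa only [hgt, hgn] using key

lemma measurableSet_cell (n j : ℕ) : MeasurableSet (cell n j) :=
  measurableSet_Ioc.preimage measurable_subtype_coe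

lemma setIntegral_cell (hn : 0 < n) (j : Fin n) (f : ℝ → ℂ) :
    ∫ t in cell n j, f t = ∫ t in ((j : ℝ) / n)..((j + 1 : ℝ) / n), f t := by
  have hn' : (0 : ℝ) < n := by exact_mod_cast hn
  have hjn : (j : ℝ) + 1 ≤ n := by exact_mod_cast j.2
  have h := unitInterval.measurePreserving_coe.setIntegral_preimage_emb
    unitInterval.measurableEmbedding_coe f (Ioc ((j : ℝ) / n) ((j + 1 : ℝ) / n))
  rw [intervalIntegral.integral_of_le (by gcongr; linarith)]
  have hsub : Ioc ((j : ℝ) / n) ((j + 1 : ℝ) / n) ⊆ I := fun t ht =>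
    ⟨le_trans (by positivity) ht.1.le, ht.2.trans (by rwa [div_le_one hn'])⟩
  rw [Measure.restrict_restrict measurableSet_Ioc, inter_eq_left.2 hsub] at h
  exact h

lemma integral_cell_refNodal (hn : 0 < n) (j : Fin n) :
    ∫ t in cell n j, (refNodal r (n * (t : ℝ) - j) : ℂ) = 0 := by
  have hn' : (n : ℝ) ≠ 0 := by positivity
  rw [setIntegral_cell hn j fun t => (refNodal r (n * t - j) : ℂ), intervalIntegral.integral_ofReal,
    intervalIntegral.integral_comp_mul_sub (refNodal r) hn']
  have h0 : (n : ℝ) * (j / n) - j = 0 := by field_simp; ring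
  have h1 : (n : ℝ) * ((j + 1) / n) - j = 1 := by field_simp; ring
  rw [h0, h1, integral_refNodal]
  simp

lemma measureReal_cell (hn : 0 < n) (j : Fin n) : volume.real (cell n j) = 1 / n := by
  have h := setIntegral_cell hn j fun _ => 1
  simp only [intervalIntegral.integral_const, setIntegral_const] at h
  have h2 : (volume.real (cell n j) : ℂ) = (1 / n : ℝ) := by
    rw [← sub_div, add_sub_cancel_left] at h
    simpa using h
  exact_mod_cast h2

/-- Integrating the node polynomial against a nearly constant function. -/
lemma norm_integral_cell_le (hn : 0 < n) (j : Fin n) {g : I → ℂ} (hg : Continuous g) {δ : ℝ}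
    (g₀ : ℂ) (hδ : ∀ t ∈ cell n j, ‖g t - g₀‖ ≤ δ) :
    ‖∫ t in cell n j, g t * (refNodal r (n * (t : ℝ) - j) : ℂ)‖ ≤ δ * (1 / n) := by
  have hc : Continuous fun t : I => (refNodal r (n * (t : ℝ) - j) : ℂ) :=
    Complex.continuous_ofReal.comp ((continuous_refNodal r).comp (by fun_prop))
  have hint : ∀ f : I → ℂ, Continuous f → Integrable f (volume.restrict (cell n j)) :=
    fun f hf => (hf.integrable_of_hasCompactSupport
      (HasCompactSupport.of_compactSpace f)).restrict
  have e : ∫ t in cell n j, g t * (refNodal r (n * (t : ℝ) - j) : ℂ) =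
      ∫ t in cell n j, (g t - g₀) * (refNodal r (n * (t : ℝ) - j) : ℂ) := by
    simp only [sub_mul]
    have i1 : Integrable (fun t : I => g t * (refNodal r (n * (t : ℝ) - j) : ℂ))
      (volume.restrict (cell n j)) := hint _ (hg.mul hc)
    have i2 : Integrable (fun t : I => g₀ * (refNodal r (n * (t : ℝ) - j) : ℂ))
      (volume.restrict (cell n j)) := hint _ (continuous_const.mul hc)
    rw [integral_sub i1 i2, integral_const_mul, integral_cell_refNodal hn, mul_zero, sub_zero]
  rw [e, ← measureReal_cell hn j]
  refine norm_setIntegral_le_of_norm_le_const (measure_lt_top _ _) fun t ht => ?_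
  obtain ⟨h0, h1⟩ := (mem_cell_iff hn).1 ht
  rw [norm_mul, Complex.norm_real, Real.norm_eq_abs]
  refine (mul_le_mul (hδ t ht) (abs_refNodal_le r ⟨h0.le, h1⟩) (abs_nonneg _)
    ((norm_nonneg _).trans (hδ t ht))).trans_eq (mul_one δ)

end Projection

/-! ### Lipschitz continuity of Green's kernels -/

section Kernel

lemma isCompact_lowerTriangle : IsCompact lowerTriangle := by
  refine ((isCompact_Icc (a := (0 : ℝ)) (b := 1)).prod
    (isCompact_Icc (a := (0 : ℝ)) (b := 1))).of_isClosed_subset ?_ fun p hp => ?_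
  · exact (isClosed_le continuous_const continuous_snd).inter
      ((isClosed_le continuous_snd continuous_fst).inter
        (isClosed_le continuous_fst continuous_const))
  · exact ⟨⟨hp.1.trans hp.2.1, hp.2.2⟩, hp.1, hp.2.1.trans hp.2.2⟩

lemma exists_lipschitz_lower {m : ℕ} (hm : m ≠ 0) {k : ℝ × ℝ → ℝ}
    (hk : ContDiffOn ℝ m k lowerTriangle) :
    ∃ L : ℝ, 0 ≤ L ∧ ∀ p ∈ lowerTriangle, ∀ q ∈ lowerTriangle, |k p - k q| ≤ L * dist p q := by
  obtain ⟨K, hK⟩ := hk.exists_lipschitzOnWith (by exact_mod_cast hm) convex_lowerTriangle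
    isCompact_lowerTriangle
  exact ⟨K, K.2, fun p hp q hq => hK.dist_le_mul p hp q hq⟩

lemma exists_lipschitz_upper {m : ℕ} (hm : m ≠ 0) {k : ℝ × ℝ → ℝ}
    (hk : ContDiffOn ℝ m k upperTriangle) :
    ∃ L : ℝ, 0 ≤ L ∧ ∀ p ∈ upperTriangle, ∀ q ∈ upperTriangle, |k p - k q| ≤ L * dist p q := by
  obtain ⟨L, hL0, hL⟩ := exists_lipschitz_lower hm (k := fun p => k p.swap)
    (hk.comp (contDiff_snd.prodMk contDiff_fst).contDiffOn fun p hp => hp)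
  refine ⟨L, hL0, fun p hp q hq => ?_⟩
  have := hL p.swap hp q.swap hq
  rwa [Prod.swap_swap, Prod.swap_swap, Prod.dist_eq, max_comm] at this

lemma lipschitz_snd_of_triangles {κ : I × I → ℝ} {L : ℝ}
    (h1 : ∀ s t t' : I, t ≤ s → t' ≤ s → |κ (s, t) - κ (s, t')| ≤ L * |(t : ℝ) - t'|)
    (h2 : ∀ s t t' : I, s ≤ t → s ≤ t' → |κ (s, t) - κ (s, t')| ≤ L * |(t : ℝ) - t'|)
    (s t t' : I) : |κ (s, t) - κ (s, t')| ≤ L * |(t : ℝ) - t'| := by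
  wlog htt : t ≤ t' generalizing t t'
  · rw [abs_sub_comm, abs_sub_comm (t : ℝ)]
    exact this t' t (le_of_not_ge htt)
  rcases le_total t' s with h | h
  · exact h1 s t t' (htt.trans h) h
  rcases le_total s t with h' | h'
  · exact h2 s t t' h' h
  refine (abs_sub_le _ (κ (s, s)) _).trans ((add_le_add (h1 s t s h' le_rfl)
    (h2 s s t' le_rfl h)).trans_eq ?_)
  have e1 : (t : ℝ) ≤ s := h'
  have e2 : (s : ℝ) ≤ t' := h
  rw [abs_of_nonpos (by linarith), abs_of_nonpos (by linarith), abs_of_nonpos (by linarith)]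
  ring

/-- A kernel of Green's function type is Lipschitz continuous in each variable. -/
lemma IsGreenKernel.exists_lipschitz {m : ℕ} (hm : m ≠ 0) {κ : C(I × I, ℝ)}
    (hκ : IsGreenKernel m κ) :
    ∃ L : ℝ, 0 ≤ L ∧ (∀ s t t' : I, |κ (s, t) - κ (s, t')| ≤ L * |(t : ℝ) - t'|) ∧
      ∀ s s' t : I, |κ (s, t) - κ (s', t)| ≤ L * |(s : ℝ) - s'| := by
  obtain ⟨κ₁, κ₂, hκ₁, hκ₂, e₁, e₂⟩ := hκ
  obtain ⟨L₁, hL₁0, hL₁⟩ := exists_lipschitz_lower hm hκ₁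
  obtain ⟨L₂, hL₂0, hL₂⟩ := exists_lipschitz_upper hm hκ₂
  have low : ∀ s t s' t' : I, t ≤ s → t' ≤ s' → |κ (s, t) - κ (s', t')| ≤
      max L₁ L₂ * dist ((s : ℝ), (t : ℝ)) ((s' : ℝ), (t' : ℝ)) := fun s t s' t' h h' => by
    rw [e₁ s t h, e₁ s' t' h']
    exact (hL₁ (s, t) ⟨t.2.1, h, s.2.2⟩ (s', t') ⟨t'.2.1, h', s'.2.2⟩).trans
      (mul_le_mul_of_nonneg_right (le_max_left _ _) dist_nonneg)
  have upp : ∀ s t s' t' : I, s ≤ t → s' ≤ t' → |κ (s, t) - κ (s', t')| ≤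
      max L₁ L₂ * dist ((s : ℝ), (t : ℝ)) ((s' : ℝ), (t' : ℝ)) := fun s t s' t' h h' => by
    rw [e₂ s t h, e₂ s' t' h']
    exact (hL₂ (s, t) ⟨s.2.1, h, t.2.2⟩ (s', t') ⟨s'.2.1, h', t'.2.2⟩).trans
      (mul_le_mul_of_nonneg_right (le_max_right _ _) dist_nonneg)
  refine ⟨max L₁ L₂, le_max_of_le_left hL₁0, lipschitz_snd_of_triangles ?_ ?_,
    fun s s' t => lipschitz_snd_of_triangles (κ := fun p => κ p.swap) ?_ ?_ t s s'⟩
  · intro s t t' h h'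
    simpa [Prod.dist_eq, Real.dist_eq] using low s t s t' h h'
  · intro s t t' h h'
    simpa [Prod.dist_eq, Real.dist_eq] using upp s t s t' h h'
  · intro s t t' h h'
    simpa [Prod.dist_eq, Real.dist_eq] using upp t s t' s h h'
  · intro s t t' h h'
    simpa [Prod.dist_eq, Real.dist_eq] using low t s t' s h h'

end Kernel

/-! ### Error bounds for the collocation operator -/

section ErrorBounds

variable {r n : ℕ}

/-- A continuous function as an element of `L^∞`. -/
abbrev toLinf (y : C(I, ℂ)) : Linf := ContinuousMap.toLp (E := ℂ) ∞ (volume : Measure I) ℂ y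

lemma norm_Linf_le {z : Linf} {B : ℝ} (hB : 0 ≤ B) (h : ∀ᵐ t : I, ‖z t‖ ≤ B) : ‖z‖ ≤ B := by
  have := Lp.norm_le_of_ae_bound hB h
  simpa using this

lemma coeFn_sub_interpOp (r n : ℕ) (y : C(I, ℂ)) :
    (toLinf y - interpOp r n y : Linf) =ᵐ[volume] fun t => y t - interpFun r n y t := by
  filter_upwards [Lp.coeFn_sub (toLinf y) (interpOp r n y), coeFn_interpOp r n y,
    ContinuousMap.coeFn_toLp (p := ∞) (𝕜 := ℂ) (volume : Measure I) y] with t h1 h2 h3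
  rw [h1, Pi.sub_apply, h2, h3]

lemma ae_exists_mem_cell (hn : 0 < n) : ∀ᵐ t : I, ∃ j : Fin n, t ∈ cell n j := by
  have h : ∀ᵐ t : I, t ≠ 0 := by
    rw [ae_iff]
    simp
  filter_upwards [h] with t ht using exists_mem_cell hn ht

lemma norm_sub_interpOp_le (hn : 0 < n) (y : C(I, ℂ)) {B : ℝ} (hB : 0 ≤ B)
    (h : ∀ j : Fin n, ∀ t ∈ cell n j, ‖y t - interpFun r n y t‖ ≤ B) :
    ‖toLinf y - interpOp r n y‖ ≤ B := by
  refine norm_Linf_le hB ?_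
  filter_upwards [coeFn_sub_interpOp r n y, ae_exists_mem_cell hn] with t h1 ⟨j, hj⟩
  rw [h1]
  exact h j t hj

lemma integralOpC_lipschitz {κ : C(I × I, ℝ)} {L : ℝ} (hL0 : 0 ≤ L)
    (hL : ∀ s s' t : I, |κ (s, t) - κ (s', t)| ≤ L * |(s : ℝ) - s'|) (x : Linf) (s s' : I) :
    ‖integralOpC κ x s - integralOpC κ x s'‖ ≤ L * |(s : ℝ) - s'| * ‖x‖ := by
  let k : C(I × I, ℝ) := ⟨fun p => κ (s, p.2) - κ (s', p.2), by fun_prop⟩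
  have hk : ‖k‖ ≤ L * |(s : ℝ) - s'| :=
    (ContinuousMap.norm_le _ (by positivity)).2 fun p => hL s s' p.2
  have e : integralOpC κ x s - integralOpC κ x s' = ∫ t : I, (k (s, t) : ℂ) * x t := by
    change (∫ t : I, (κ (s, t) : ℂ) * x t) - (∫ t : I, (κ (s', t) : ℂ) * x t) = _
    rw [← integral_sub (integrable_kernel κ x s) (integrable_kernel κ x s')]
    refine integral_congr_ae (Filter.Eventually.of_forall fun t => ?_)
    simp only [k, ContinuousMap.coe_mk]
    push_cast
    ring
  rw [e]
  exact (norm_integral_kernel_le k x s).trans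
    (mul_le_mul_of_nonneg_right hk (norm_nonneg _))

/-- `𝒦 - Q_n 𝒦` is of order `h` in norm. -/
lemma norm_integralOp_sub_collocationOp_le {κ : C(I × I, ℝ)} {L Λ : ℝ} (hL0 : 0 ≤ L)
    (hL : ∀ s s' t : I, |κ (s, t) - κ (s', t)| ≤ L * |(s : ℝ) - s'|)
    (hΛ0 : 0 ≤ Λ) (hΛ : ∀ u ∈ Icc (0 : ℝ) 1, ∑ i, |refBasis r i u| ≤ Λ) (hn : 0 < n) :
    ‖integralOp κ - collocationOp r n κ‖ ≤ (1 + Λ) * L * (1 / n) := by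
  have hn' : (0 : ℝ) < n := by exact_mod_cast hn
  refine ContinuousLinearMap.opNorm_le_bound _ (by positivity) fun x => ?_
  set y := integralOpC κ x with hy
  change ‖toLinf y - interpOp r n y‖ ≤ _
  refine norm_sub_interpOp_le hn y (by positivity) fun j t ht => ?_
  have hjn : (j : ℝ) + 1 ≤ n := by exact_mod_cast j.2
  let a : I := ⟨j / n, by positivity, by rw [div_le_one hn']; linarith⟩
  let c : ℕ → ℂ := fun m => if m = 0 then y a else 0
  have hsum : ∀ u : ℂ, ∑ m ∈ Finset.range (2 * r + 2), c m * u ^ m = y a := fun u => by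
    rw [Finset.sum_eq_single_of_mem 0 (by simp) fun m _ hm => by simp [c, hm]]
    simp [c]
  have hctop : c (2 * r + 1) = 0 := if_neg (by omega)
  have h := norm_sub_interpFun_le (r := r) (c := c) (ε := L * (1 / n) * ‖x‖) hΛ hn y j
    (by positivity) (fun s h0 h1 => by
      rw [hsum]
      refine (integralOpC_lipschitz hL0 hL x s a).trans ?_
      have : |(s : ℝ) - a| ≤ 1 / n := by
        have e : (s : ℝ) - a = (n * (s : ℝ) - j) / n := by
          simp only [a]; field_simp
        rw [e, abs_of_nonneg (by positivity)]
        gcongr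
      gcongr) ht
  rw [hctop, zero_mul, sub_zero] at h
  exact h.trans_eq (by ring)

/-- Interpolation error for a smooth function: its order in norm, and the higher order after
integration against a Lipschitz kernel. -/
lemma exists_smooth_error_bound {κ : C(I × I, ℝ)} {L : ℝ} (hL0 : 0 ≤ L)
    (hL : ∀ s t t' : I, |κ (s, t) - κ (s, t')| ≤ L * |(t : ℝ) - t'|)
    {y : C(I, ℂ)} {f : ℝ → ℂ} (hf : ContDiffOn ℝ ((2 * r + 2 : ℕ)) f (Icc 0 1))
    (hfy : ∀ t : I, f t = y t) :
    ∃ C : ℝ, 0 ≤ C ∧ ∀ n : ℕ, 0 < n →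
      ‖toLinf y - interpOp r n y‖ ≤ C * (1 / (n : ℝ)) ^ (2 * r + 1) ∧
      ‖integralOp κ (toLinf y - interpOp r n y)‖ ≤ C * (1 / (n : ℝ)) ^ (2 * r + 2) := by
  obtain ⟨Λ, hΛ0, hΛ⟩ := exists_lebesgue_const r
  obtain ⟨M, hM0, hM⟩ := exists_uniform_taylor (2 * r + 2) hf
  refine ⟨M * (L + ‖κ‖ * (1 + Λ)) + M * (1 + (1 + Λ)), by positivity, fun n hn => ?_⟩
  have hn' : (0 : ℝ) < n := by exact_mod_cast hn
  set h : ℝ := 1 / n with hh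
  have hh0 : 0 < h := by positivity
  have hh1 : h ≤ 1 := by
    rw [hh, div_le_one hn']
    exact_mod_cast hn
  have hnh : (n : ℝ) * h = 1 := by rw [hh]; field_simp
  have cells : ∀ j : Fin n, ∃ c : ℂ, ‖c‖ ≤ M * h ^ (2 * r + 1) ∧ ∀ t ∈ cell n j,
      ‖y t - interpFun r n y t - c * (refNodal r (n * (t : ℝ) - j) : ℂ)‖ ≤
        (1 + Λ) * (M * h ^ (2 * r + 2)) := by
    intro j
    have hjn : (j : ℝ) + 1 ≤ n := by exact_mod_cast j.2
    have ha : (j : ℝ) / n ∈ Icc (0 : ℝ) 1 := ⟨by positivity, by rw [div_le_one hn']; linarith⟩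
    obtain ⟨c, hc, hct⟩ := hM _ ha
    refine ⟨c (2 * r + 1) * (h : ℂ) ^ (2 * r + 1), ?_, fun t ht => ?_⟩
    · rw [norm_mul, norm_pow, Complex.norm_real, Real.norm_of_nonneg hh0.le]
      exact mul_le_mul_of_nonneg_right (hc _) (by positivity)
    · refine norm_sub_interpFun_le (c := fun m => c m * (h : ℂ) ^ m) hΛ hn y j (by positivity)
        (fun s h0 h1 => ?_) ht
      have e : (s : ℝ) - j / n = h * (n * (s : ℝ) - j) := by rw [hh]; field_simp
      have hs0 : (0 : ℝ) ≤ s - j / n := by rw [e]; positivity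
      have hsh : (s : ℝ) - j / n ≤ h := by
        rw [e]
        exact mul_le_of_le_one_right hh0.le h1
      have := hct s ⟨by linarith, s.2.2⟩
      rw [hfy] at this
      refine le_trans (le_of_eq ?_) (this.trans ?_)
      · congr 2
        refine Finset.sum_congr rfl fun m _ => ?_
        rw [e, Complex.ofReal_mul, mul_pow, mul_assoc]
      · gcongr
  choose c hc hct using cells
  have hpow : h ^ (2 * r + 2) ≤ h ^ (2 * r + 1) :=
    pow_le_pow_of_le_one hh0.le hh1 (by omega)
  constructor
  · refine norm_sub_interpOp_le hn y (by positivity) fun j t ht => ?_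
    obtain ⟨h0, h1⟩ := (mem_cell_iff hn).1 ht
    have h2 : ‖c j * (refNodal r (n * (t : ℝ) - j) : ℂ)‖ ≤ M * h ^ (2 * r + 1) := by
      rw [norm_mul, Complex.norm_real, Real.norm_eq_abs]
      exact (mul_le_mul (hc j) (abs_refNodal_le r ⟨h0.le, h1⟩) (abs_nonneg _)
        (by positivity)).trans_eq (mul_one _)
    have h3 := norm_sub_norm_le (y t - interpFun r n y t)
      (c j * (refNodal r (n * (t : ℝ) - j) : ℂ))
    have h4 : (1 + Λ) * (M * h ^ (2 * r + 2)) ≤ (1 + Λ) * (M * h ^ (2 * r + 1)) := by gcongr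
    have h5 : 0 ≤ M * (L + ‖κ‖ * (1 + Λ)) * h ^ (2 * r + 1) := by positivity
    have h6 := hct j t ht
    linarith
  · refine norm_Linf_le (by positivity) ?_
    filter_upwards [ContinuousMap.coeFn_toLp (p := ∞) (𝕜 := ℂ) (volume : Measure I)
      (integralOpC κ (toLinf y - interpOp r n y))] with s hs
    change ‖toLinf (integralOpC κ (toLinf y - interpOp r n y)) s‖ ≤ _
    rw [hs]
    set z : Linf := toLinf y - interpOp r n y with hz
    have hzae := coeFn_sub_interpOp r n y
    change ‖∫ t : I, (κ (s, t) : ℂ) * z t‖ ≤ _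
    have hcover : volume.restrict (⋃ j : Fin n, cell n j) = (volume : Measure I) := by
      refine Measure.restrict_eq_self_of_ae_mem ?_
      filter_upwards [ae_exists_mem_cell hn] with t ht using mem_iUnion.2 ht
    have hsplit : ∫ t : I, (κ (s, t) : ℂ) * z t =
        ∑ j : Fin n, ∫ t in cell n j, (κ (s, t) : ℂ) * z t := by
      rw [← integral_iUnion_fintype (s := fun j : Fin n => cell n j)
        (fun j => measurableSet_cell n j) (fun j k hjk => ?_)
        (fun j => (integrable_kernel κ z s).integrableOn), hcover]
      refine Set.disjoint_left.2 fun t hj hk => hjk (Fin.ext (cell_unique hn hj hk))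
    have hκc : Continuous fun t : I => (κ (s, t) : ℂ) := by fun_prop
    have hωc : ∀ j : ℕ, Continuous fun t : I => (refNodal r (n * (t : ℝ) - j) : ℂ) := fun j =>
      Complex.continuous_ofReal.comp ((continuous_refNodal r).comp (by fun_prop))
    have hcell : ∀ j : Fin n, ‖∫ t in cell n j, (κ (s, t) : ℂ) * z t‖ ≤
        M * (L + ‖κ‖ * (1 + Λ)) * h ^ (2 * r + 2) * h := by
      intro j
      have hjn : (j : ℝ) + 1 ≤ n := by exact_mod_cast j.2
      let a : I := ⟨j / n, by positivity, by rw [div_le_one hn']; linarith⟩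
      have i1 : Integrable (fun t : I => (κ (s, t) : ℂ) * z t) (volume.restrict (cell n j)) :=
        (integrable_kernel κ z s).restrict
      have i2 : Integrable
          (fun t : I => c j * ((κ (s, t) : ℂ) * (refNodal r (n * (t : ℝ) - j) : ℂ)))
          (volume.restrict (cell n j)) :=
        ((continuous_const.mul (hκc.mul (hωc j))).integrable_of_hasCompactSupport
          (HasCompactSupport.of_compactSpace _)).restrict
      have e : ∫ t in cell n j, (κ (s, t) : ℂ) * z t =
          (∫ t in cell n j, ((κ (s, t) : ℂ) * z t -
            c j * ((κ (s, t) : ℂ) * (refNodal r (n * (t : ℝ) - j) : ℂ)))) +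
          c j * ∫ t in cell n j, (κ (s, t) : ℂ) * (refNodal r (n * (t : ℝ) - j) : ℂ) := by
        rw [integral_sub i1 i2, integral_const_mul, sub_add_cancel]
      have b1 : ‖∫ t in cell n j, ((κ (s, t) : ℂ) * z t -
          c j * ((κ (s, t) : ℂ) * (refNodal r (n * (t : ℝ) - j) : ℂ)))‖ ≤
          ‖κ‖ * ((1 + Λ) * (M * h ^ (2 * r + 2))) * h := by
        have hμ : volume.real (cell n j) = h := measureReal_cell hn j
        rw [← hμ]
        refine norm_setIntegral_le_of_norm_le_const_ae' (measure_lt_top _ _) ?_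
        filter_upwards [hzae] with t ht htc
        have e2 : (κ (s, t) : ℂ) * z t -
            c j * ((κ (s, t) : ℂ) * (refNodal r (n * (t : ℝ) - j) : ℂ)) =
            (κ (s, t) : ℂ) * (y t - interpFun r n y t -
              c j * (refNodal r (n * (t : ℝ) - j) : ℂ)) := by
          rw [ht]; ring
        rw [e2, norm_mul, Complex.norm_real, hμ]
        exact mul_le_mul (κ.norm_coe_le_norm _) (hct j t htc) (norm_nonneg _) (norm_nonneg _)
      have b2 : ‖∫ t in cell n j, (κ (s, t) : ℂ) * (refNodal r (n * (t : ℝ) - j) : ℂ)‖ ≤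
          L * h * h := by
        refine norm_integral_cell_le hn j hκc (κ (s, a) : ℂ) fun t ht => ?_
        obtain ⟨h0, h1⟩ := (mem_cell_iff hn).1 ht
        rw [← Complex.ofReal_sub, Complex.norm_real, Real.norm_eq_abs]
        refine (hL s t a).trans (mul_le_mul_of_nonneg_left ?_ hL0)
        have e2 : (t : ℝ) - a = h * (n * (t : ℝ) - j) := by
          simp only [a, hh]; field_simp
        rw [e2, abs_of_nonneg (by positivity)]
        exact mul_le_of_le_one_right hh0.le h1
      rw [e]
      refine (norm_add_le _ _).trans ?_
      rw [norm_mul]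
      calc _ ≤ ‖κ‖ * ((1 + Λ) * (M * h ^ (2 * r + 2))) * h +
            M * h ^ (2 * r + 1) * (L * h * h) :=
          add_le_add b1 (mul_le_mul (hc j) b2 (norm_nonneg _) (by positivity))
        _ = M * (L + ‖κ‖ * (1 + Λ)) * h ^ (2 * r + 2) * h := by ring
    rw [hsplit]
    refine (norm_sum_le _ _).trans ((Finset.sum_le_sum fun j _ => hcell j).trans ?_)
    rw [Finset.sum_const, Finset.card_univ, Fintype.card_fin, nsmul_eq_mul]
    have h7 : 0 ≤ M * (1 + (1 + Λ)) * h ^ (2 * r + 2) := by positivity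
    calc (n : ℝ) * (M * (L + ‖κ‖ * (1 + Λ)) * h ^ (2 * r + 2) * h)
        = (M * (L + ‖κ‖ * (1 + Λ)) * h ^ (2 * r + 2)) * (n * h) := by ring
      _ ≤ _ := by rw [hnh]; linarith

end ErrorBounds

/-! ### Smoothness of the eigenfunctions -/

lemma integral_unitInterval_eq (g : ℝ → ℂ) : ∫ t : I, g t = ∫ t in (0 : ℝ)..1, g t := by
  rw [intervalIntegral.integral_of_le zero_le_one, ← integral_Icc_eq_integral_Ioc]
  exact integral_subtype_comap measurableSet_Icc g

/-- An eigenfunction of the integral operator for a nonzero eigenvalue has a smooth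
representative. -/
lemma exists_smooth_eigenfunction {m : ℕ} {κ : C(I × I, ℝ)} (hκ : IsGreenKernel m κ) {lam : ℂ}
    (hlam : lam ≠ 0) {φ : Linf} (hφ : integralOp κ φ = lam • φ) :
    ∃ y : C(I, ℂ), integralOpC κ φ = lam • y ∧
      ∃ f : ℝ → ℂ, ContDiffOn ℝ m f (Icc 0 1) ∧ ∀ t : I, f t = y t := by
  obtain ⟨κ₁, κ₂, hκ₁, hκ₂, e₁, e₂⟩ := hκ
  set y : C(I, ℂ) := lam⁻¹ • integralOpC κ φ with hy
  have hKy : integralOpC κ φ = lam • y := by rw [hy, smul_inv_smul₀ hlam]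
  have hφy : φ = toLinf y := by
    have h : toLinf (integralOpC κ φ) = lam • φ := hφ
    rw [hKy, toLinf, map_smul] at h
    exact (smul_right_injective Linf hlam h).symm
  set f : ℝ → ℂ := fun t => y (projIcc 0 1 zero_le_one t) with hf
  have hfy : ∀ t : I, f t = y t := fun t => by rw [hf]; simp only [projIcc_val]
  have hfc : Continuous f := y.continuous.comp continuous_projIcc
  refine ⟨y, hKy, f, ?_, hfy⟩
  refine contDiffOn_of_eigen hlam (k₁ := fun p => (κ₁ p : ℂ)) (k₂ := fun p => (κ₂ p : ℂ))
    (Complex.ofRealCLM.contDiff.comp_contDiffOn hκ₁)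
    (Complex.ofRealCLM.contDiff.comp_contDiffOn hκ₂) hfc.continuousOn fun s hs => ?_
  set G : ℝ → ℂ := fun t => (κ (⟨s, hs⟩, projIcc 0 1 zero_le_one t) : ℂ) * f t with hG
  have hGc : Continuous G := by
    refine Continuous.mul ?_ hfc
    exact Complex.continuous_ofReal.comp (κ.continuous.comp
      (continuous_const.prodMk continuous_projIcc))
  have hsplit : lam * f s = ∫ t in (0 : ℝ)..1, G t := by
    have h1 : lam * f s = integralOpC κ φ ⟨s, hs⟩ := by
      rw [hKy]
      exact congrArg (lam * ·) (hfy ⟨s, hs⟩)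
    rw [h1, ← integral_unitInterval_eq]
    change ∫ t : I, (κ (⟨s, hs⟩, t) : ℂ) * φ t = _
    refine integral_congr_ae ?_
    rw [hφy]
    filter_upwards [ContinuousMap.coeFn_toLp (p := ∞) (𝕜 := ℂ) (volume : Measure I) y] with t ht
    rw [ht, hG]
    simp only [projIcc_val, hfy]
  rw [hsplit, ← intervalIntegral.integral_add_adjacent_intervals
    (hGc.intervalIntegrable 0 s) (hGc.intervalIntegrable s 1)]
  congr 1
  · refine intervalIntegral.integral_congr fun t ht => ?_
    rw [uIcc_of_le hs.1] at ht
    have htI : t ∈ Icc (0 : ℝ) 1 := ⟨ht.1, ht.2.trans hs.2⟩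
    simp only [hG, projIcc_of_mem zero_le_one htI]
    rw [e₁ ⟨s, hs⟩ ⟨t, htI⟩ ht.2]
  · refine intervalIntegral.integral_congr fun t ht => ?_
    rw [uIcc_of_le hs.2] at ht
    have htI : t ∈ Icc (0 : ℝ) 1 := ⟨hs.1.trans ht.1, ht.2⟩
    simp only [hG, projIcc_of_mem zero_le_one htI]
    rw [e₂ ⟨s, hs⟩ ⟨t, htI⟩ ht.1]

end Collocation
end

theorem mainTheorem3 (r : ℕ) (κ : C(I × I, ℝ)) (hκ : Collocation.IsGreenKernel (2 * r + 2) κ)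
    (lam : ℂ) (hlam : lam ≠ 0) (c : ℂ) (R : ℝ)
    (hsimple : Collocation.IsSimpleEigenvalueIn (Collocation.integralOp κ) c R lam) :
    ∃ (C : ℝ) (N : ℕ), ∀ n : ℕ, N ≤ n →
      ∃ lamC : ℂ, lamC ≠ 0 ∧
        Collocation.IsSimpleEigenvalueIn (Collocation.collocationOp r n κ) c R lamC ∧
        ‖lam - lamC‖ ≤ C * (1 / (n : ℝ)) ^ (2 * r + 2) ∧
        ∀ φ φS : Collocation.Linf,
          φ ∈ LinearMap.range (Collocation.spectralProj (Collocation.collocationOp r n κ) c R :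
            Collocation.Linf →ₗ[ℂ] Collocation.Linf) →
          ‖φ‖ = 1 →
          φS = lamC⁻¹ • Collocation.integralOp κ φ →
          Collocation.collocationOp r n κ φ = lamC • φ ∧
          ‖φ - Collocation.spectralProj (Collocation.integralOp κ) c R φ‖
            ≤ C * (1 / (n : ℝ)) ^ (2 * r + 1) ∧
          ‖φS - Collocation.spectralProj (Collocation.integralOp κ) c R φS‖
            ≤ C * (1 / (n : ℝ)) ^ (2 * r + 2) := by
  have hrank : Module.finrank ℂ (LinearMap.range
      ((Collocation.rieszProj (Collocation.integralOp κ) c R :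
        Collocation.Linf →L[ℂ] Collocation.Linf) :
        Collocation.Linf →ₗ[ℂ] Collocation.Linf)) = 1 := hsimple.rank_eq_one
  have hΓ := hsimple.circle_subset
  have hball : lam ∈ Metric.ball c R :=
    (hsimple.spectrum_inside.symm.subset (mem_singleton lam)).2
  have hR : 0 < R := dist_nonneg.trans_lt (Metric.mem_ball.1 hball)
  obtain ⟨μ, -, hTP, hμ, -⟩ := Collocation.exists_eigenvalue_of_rank_one hR hΓ hrank
  obtain rfl : lam = μ := singleton_injective (hsimple.spectrum_inside.symm.trans hμ)
  -- a normalized eigenfunction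
  obtain ⟨φ₀, hφ₀, hPφ₀⟩ : ∃ φ₀ : Collocation.Linf, ‖φ₀‖ = 1 ∧
      Collocation.rieszProj (Collocation.integralOp κ) c R φ₀ = φ₀ := by
    obtain ⟨⟨v, hv⟩, hv0, -⟩ := finrank_eq_one_iff'.1 hrank
    have hv0 : v ≠ 0 := fun h => hv0 (Subtype.ext h)
    refine ⟨((‖v‖⁻¹ : ℝ) : ℂ) • v, ?_, ?_⟩
    · rw [norm_smul, Complex.norm_real, norm_inv, norm_norm,
        inv_mul_cancel₀ (norm_ne_zero_iff.2 hv0)]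
    · rw [map_smul, Collocation.rieszProj_apply_of_mem_range hR hΓ hv]
  have hTφ₀ : Collocation.integralOp κ φ₀ = lam • φ₀ := by
    have h := DFunLike.congr_fun hTP φ₀
    change Collocation.integralOp κ (Collocation.rieszProj (Collocation.integralOp κ) c R φ₀) =
      lam • Collocation.rieszProj (Collocation.integralOp κ) c R φ₀ at h
    rwa [hPφ₀] at h
  obtain ⟨e₀, he₀, K, hK0, hK⟩ :=
    Collocation.exists_perturbed_eigenvalue hlam hR hΓ hball hTP hrank hφ₀ hPφ₀
  obtain ⟨L, hL0, hLt, hLs⟩ := hκ.exists_lipschitz (by omega)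
  obtain ⟨Λ, hΛ0, hΛ⟩ := Collocation.exists_lebesgue_const r
  obtain ⟨y, hy, f, hf, hfy⟩ := Collocation.exists_smooth_eigenfunction hκ hlam hTφ₀
  obtain ⟨C₁, hC₁0, hC₁⟩ := Collocation.exists_smooth_error_bound hL0 hLt hf hfy
  set C₀ : ℝ := (1 + Λ) * L with hC₀
  have hC₀0 : 0 ≤ C₀ := by positivity
  obtain ⟨N, hN⟩ := exists_nat_gt (C₀ / e₀)
  refine ⟨K * (‖lam‖ * C₁ * (C₀ + 1)), max N 1, fun n hn => ?_⟩
  have hn0 : 0 < n := (le_max_right N 1).trans hn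
  have hn' : (0 : ℝ) < n := by exact_mod_cast hn0
  have hNn : (N : ℝ) ≤ n := by exact_mod_cast (le_max_left N 1).trans hn
  have hdist := Collocation.norm_integralOp_sub_collocationOp_le hL0 hLs hΛ0 hΛ hn0
  have hsmall : ‖Collocation.integralOp κ - Collocation.collocationOp r n κ‖ ≤ e₀ := by
    refine hdist.trans ?_
    rw [mul_one_div, div_le_iff₀ hn']
    have := (div_lt_iff₀ he₀).1 hN
    nlinarith
  have hdiff : (Collocation.integralOp κ - Collocation.collocationOp r n κ) φ₀ =
      lam • (Collocation.toLinf y - Collocation.interpOp r n y) := by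
    change Collocation.toLinf (Collocation.integralOpC κ φ₀) -
      Collocation.interpOp r n (Collocation.integralOpC κ φ₀) = _
    rw [hy, Collocation.toLinf, map_smul, map_smul, smul_sub]
  obtain ⟨hb1, hb2⟩ := hC₁ n hn0
  obtain ⟨hΓn, hrankn, μ, hμ0, hspec, heig, hval, hvec⟩ := hK _ hsmall
  set h : ℝ := 1 / n with hh
  have hh0 : 0 ≤ h := by positivity
  have ha : ‖(Collocation.integralOp κ - Collocation.collocationOp r n κ) φ₀‖ ≤
      ‖lam‖ * C₁ * h ^ (2 * r + 1) := by
    rw [hdiff, norm_smul, mul_assoc]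
    exact mul_le_mul_of_nonneg_left hb1 (norm_nonneg _)
  have hb : ‖Collocation.integralOp κ
      ((Collocation.integralOp κ - Collocation.collocationOp r n κ) φ₀)‖ ≤
      ‖lam‖ * C₁ * h ^ (2 * r + 2) := by
    rw [hdiff, map_smul, norm_smul, mul_assoc]
    exact mul_le_mul_of_nonneg_left hb2 (norm_nonneg _)
  have hsuper : K * (‖Collocation.integralOp κ - Collocation.collocationOp r n κ‖ *
      ‖(Collocation.integralOp κ - Collocation.collocationOp r n κ) φ₀‖ +
      ‖Collocation.integralOp κ
        ((Collocation.integralOp κ - Collocation.collocationOp r n κ) φ₀)‖) ≤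
      K * (‖lam‖ * C₁ * (C₀ + 1)) * h ^ (2 * r + 2) := by
    rw [mul_assoc]
    refine mul_le_mul_of_nonneg_left ?_ hK0
    refine (add_le_add (mul_le_mul hdist ha (norm_nonneg _) (by positivity)) hb).trans_eq ?_
    ring
  refine ⟨μ, hμ0, ⟨hΓn, hspec, heig, hrankn⟩, hval.trans hsuper, ?_⟩
  rintro φ φS hφ hφ1 rfl
  obtain ⟨h1, h2, h3⟩ := hvec φ hφ hφ1
  refine ⟨h1, h2.trans ?_, h3.trans hsuper⟩
  rw [mul_assoc]
  refine mul_le_mul_of_nonneg_left (ha.trans ?_) hK0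
  have : 0 ≤ ‖lam‖ * C₁ * C₀ * h ^ (2 * r + 1) := by positivity
  linarith
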